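/- Let $n\ge 0$ and $X=\mathbb{R}^n$ (Euclidean), and let $d_X(x,y,z)$ be the area of the triangle spanned by $x,y,z$. Let $A$ be the graph on $X$ with exactly one arrow $*_{x,y}$ from $x$ to $y$ for all $x,y\in X$ (so $A(x,y)=\{*_{x,y}\}$, $1_x=*_{x,x}$), and put $d(*_{x,y},*_{y,z},*_{x,z}):=d_X(x,y,z)$; this is an approximate categorical structure (AC structure): with $d$ defined on triples $f\in A(x,y)$, $g\in A(y,z)$, $h\in A(x,z)$ one has $d(f,1_y,f)=d(1_x,f,f)=0$ and, for $f:x\to y$, $g:y\to z$, $h:z\to w$, $a:x\to z$, $b:y\to w$, $c:x\to w$, both $d(a,h,c)\le d(f,g,a)+d(g,h,b)+d(f,b,c)$ and $d(f,b,c)\le d(f,g,a)+d(g,h,b)+d(a,h,c)$. Let $\mathbf{Free}(X,A)$ be the free category on this graph. An arrow from $x$ to $y$ is a finite sequence of points $(x_0,\dots,x_k)$, $k\ge 0$, with $x_0=x$, $x_k=y$, regarded as the piecewise linear path through these points; composition is concatenation. A *functorial distance* is a family of pseudometrics $\varphi$ on the sets $\mathbf{Free}(X,A)(x,y)$ such that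 $\varphi(g\circ f,g'\circ f')\le\varphi(f,f')+\varphi(g,g')$ for all $f,f':x\to y$ and $g,g':y\to z$, such that $\varphi((f,g),(h))\le d(f,g,h)$ for all $f\in A(x,y)$, $g\in A(y,z)$, $h\in A(x,z)$, where $(f,g)$ is the composite in $\mathbf{Free}(X,A)$, and such that $\varphi((1_x),()_x)=0$, where $()_x$ is the identity of $x$ in $\mathbf{Free}(X,A)$. Let $d^{\max}(f,g)$ be the supremum of $\varphi(f,g)$ over all functorial distances $\varphi$. For a piecewise linear map $s:D\to\mathbb{R}^n$ on a compact convex polygonal region $D\subset\mathbb{R}^2$ (with nonempty interior), let $\mathrm{Area}(D,s)$ be the sum of the areas of the images of the triangles in a division of $D$ into triangles on which $s$ is affine, and let $\partial s$ be the restriction of $s$ to $\partial D$, a closed piecewise linear path. For piecewise linear paths $f,g$ from $x$ to $y$, let $g^{-1}f$ be the closed path which follows $f$ and then $g$ backwards, and put $$d_{\mathrm{Area}}(f,g):=\inf\{\mathrm{Area}(D,s)\;:\;\partial s=g^{-1}f\},$$ where $\partial s=g^{-1}f$ means equality of based closed paths up to reparametrization. **Theorem.** The function $d^{\max}$ is finite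 and is itself a functorial distance, hence the largest one. For all $x,y\in\mathbb{R}^n$ and all piecewise linear paths $f,g\in\mathbf{Free}(X,A)(x,y)$ the set of $(D,s)$ with $\partial s=g^{-1}f$ is nonempty and $$d^{\max}(f,g)=d_{\mathrm{Area}}(f,g).$$ In particular, for $f\in A(x,y)$, $g\in A(y,z)$ and $h\in A(x,z)$, $$d(f,g,h)=d_X(x,y,z)=d^{\max}(g\circ f,h),$$ where $g\circ f$ denotes the composite $(f,g)$ in $\mathbf{Free}(X,A)$. -/

import Mathlib

open CategoryTheory Set

universe u v

/-! ### Approximate categorical structures and functorial distances -/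

/-- An approximate categorical structure (AC structure) on a graph `X`: chosen identity arrows and
a triangular distance `d f g h`, defined for `f : x ⟶ y`, `g : y ⟶ z`, `h : x ⟶ z`. -/
structure ACStructure (X : Type u) [Quiver.{v} X] where
  unit : ∀ x : X, x ⟶ x
  d : ∀ {x y z : X}, (x ⟶ y) → (y ⟶ z) → (x ⟶ z) → ℝ
  left_identity : ∀ {x y : X} (f : x ⟶ y), d f (unit y) f = 0
  right_identity : ∀ {x y : X} (f : x ⟶ y), d (unit x) f f = 0
  left_assoc : ∀ {x y z w : X} (f : x ⟶ y) (g : y ⟶ z) (h : z ⟶ w)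
    (a : x ⟶ z) (b : y ⟶ w) (c : x ⟶ w), d a h c ≤ d f g a + d g h b + d f b c
  right_assoc : ∀ {x y z w : X} (f : x ⟶ y) (g : y ⟶ z) (h : z ⟶ w)
    (a : x ⟶ z) (b : y ⟶ w) (c : x ⟶ w), d f b c ≤ d f g a + d g h b + d a h c

/-- `φ` is a pseudometric structure on the category `C` (making it a pseudo-metrized category):
a pseudometric on every hom-set for which composition is nonincreasing with respect to the sum
pseudometric on pairs of composable arrows. -/
structure IsPseudoMetrized (C : Type u) [Category.{v} C]
    (φ : ∀ ⦃x y : C⦄, (x ⟶ y) → (x ⟶ y) → ℝ) : Prop where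
  self : ∀ {x y : C} (f : x ⟶ y), φ f f = 0
  symm : ∀ {x y : C} (f g : x ⟶ y), φ f g = φ g f
  triangle : ∀ {x y : C} (f g h : x ⟶ y), φ f g ≤ φ f h + φ h g
  comp_le : ∀ {x y z : C} (f f' : x ⟶ y) (g g' : y ⟶ z),
    φ (f ≫ g) (f' ≫ g') ≤ φ f f' + φ g g'

/-- A functorial distance of the AC structure `S`: a pseudometric structure `φ` on the free
category `Paths X` with `φ ((f, g), (h)) ≤ d f g h` and `φ ((1ₓ), ()ₓ) = 0`. -/
structure IsFunctorialDistance {X : Type u} [Quiver.{v} X] (S : ACStructure X)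
    (φ : ∀ ⦃x y : Paths X⦄, (x ⟶ y) → (x ⟶ y) → ℝ) : Prop
    extends IsPseudoMetrized (Paths X) φ where
  le_d : ∀ {x y z : X} (f : x ⟶ y) (g : y ⟶ z) (h : x ⟶ z),
    φ ((Paths.of X).map f ≫ (Paths.of X).map g) ((Paths.of X).map h) ≤ S.d f g h
  unit : ∀ x : X, φ ((Paths.of X).map (S.unit x)) (𝟙 ((Paths.of X).obj x)) = 0

/-- The supremum `d^max` of all functorial distances on the free category. -/
noncomputable def dMax {X : Type u} [Quiver.{v} X] (S : ACStructure X)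
    ⦃x y : Paths X⦄ (f g : x ⟶ y) : ℝ :=
  sSup {r : ℝ | ∃ φ : ∀ ⦃x y : Paths X⦄, (x ⟶ y) → (x ⟶ y) → ℝ,
    IsFunctorialDistance S φ ∧ r = φ f g}

/-! ### The AC structure of a 2-metric -/

/-- A `2`-metric (symmetry, vanishing on degenerate triples, tetrahedral inequality). -/
structure TwoMetric (X : Type u) where
  dist : X → X → X → ℝ
  symm_left : ∀ x y z, dist x y z = dist y x z
  symm_right : ∀ x y z, dist x y z = dist x z y
  zero : ∀ x y, dist x x y = 0
  tetrahedral : ∀ x y z w, dist x y w ≤ dist x y z + dist y z w + dist x z w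

/-- The points of `X`, viewed as the objects of the graph with exactly one arrow `∗` from every
object to every object. -/
structure Coarse (X : Type u) : Type u where
  pt : X

instance Coarse.quiver (X : Type u) : Quiver.{0} (Coarse X) where
  Hom _ _ := Unit

/-- The AC structure on the coarse graph associated to a `2`-metric. -/
def TwoMetric.toAC {X : Type u} (T : TwoMetric X) : ACStructure (Coarse X) where
  unit _ := ()
  d {x y z} _ _ _ := T.dist x.pt y.pt z.pt
  left_identity {x y} _ := by
    rw [T.symm_left, T.symm_right]; exact T.zero y.pt x.pt
  right_identity {x y} _ := T.zero x.pt y.pt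
  left_assoc {x y z w} _ _ _ _ _ _ := by
    have h := T.tetrahedral x.pt z.pt y.pt w.pt
    rw [T.symm_right x.pt z.pt y.pt, T.symm_left z.pt y.pt w.pt] at h
    exact h
  right_assoc {x y z w} _ _ _ _ _ _ := T.tetrahedral x.pt y.pt z.pt w.pt

/-! ### The area 2-metric on `ℝⁿ` -/

/-- The area of the triangle with vertices `x`, `y`, `z` in `ℝⁿ`:
half of the area of the parallelogram spanned by `y - x` and `z - x`. -/
noncomputable def triArea {n : ℕ} (x y z : EuclideanSpace ℝ (Fin n)) : ℝ :=
  √(‖y - x‖ ^ 2 * ‖z - x‖ ^ 2 - (inner ℝ (y - x) (z - x)) ^ 2) / 2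

/-- Coordinates of the bivector `(y - x) ∧ (z - x)`; an auxiliary device for `areaTwoMetric`. -/
noncomputable def triBivector {n : ℕ} (x y z : EuclideanSpace ℝ (Fin n)) :
    EuclideanSpace ℝ (Fin n × Fin n) :=
  WithLp.toLp 2 fun p => (y p.1 - x p.1) * (z p.2 - x p.2) - (y p.2 - x p.2) * (z p.1 - x p.1)

theorem triArea_eq_norm {n : ℕ} (x y z : EuclideanSpace ℝ (Fin n)) :
    triArea x y z = ‖triBivector x y z‖ / (2 * √2) := by
  have key : ‖triBivector x y z‖ ^ 2 =
      2 * (‖y - x‖ ^ 2 * ‖z - x‖ ^ 2 - (inner ℝ (y - x) (z - x)) ^ 2) := by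
    simp only [EuclideanSpace.norm_sq_eq, PiLp.inner_apply, triBivector, PiLp.sub_apply,
      Real.norm_eq_abs, sq_abs, RCLike.inner_apply, conj_trivial, Fintype.sum_prod_type]
    set a : Fin n → ℝ := fun i => y i - x i
    set b : Fin n → ℝ := fun i => z i - x i
    change ∑ i, ∑ j, (a i * b j - a j * b i) ^ 2 =
      2 * ((∑ i, a i ^ 2) * (∑ i, b i ^ 2) - (∑ i, b i * a i) ^ 2)
    have h1 : (∑ i, a i ^ 2) * (∑ i, b i ^ 2) = ∑ i, ∑ j, a i ^ 2 * b j ^ 2 :=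
      Finset.sum_mul_sum _ _ _ _
    have h2 : (∑ i, a i ^ 2) * (∑ i, b i ^ 2) = ∑ i, ∑ j, a j ^ 2 * b i ^ 2 := by
      rw [h1, Finset.sum_comm]
    have h3 : (∑ i, b i * a i) ^ 2 = ∑ i, ∑ j, (b i * a i) * (b j * a j) := by
      rw [sq, Finset.sum_mul_sum]
    have h4 : 2 * ((∑ i, a i ^ 2) * (∑ i, b i ^ 2) - (∑ i, b i * a i) ^ 2) =
        (∑ i, a i ^ 2) * (∑ i, b i ^ 2) + (∑ i, a i ^ 2) * (∑ i, b i ^ 2)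
          - 2 * (∑ i, b i * a i) ^ 2 := by ring
    rw [h4, h3]
    nth_rewrite 1 [h1]
    rw [h2, Finset.mul_sum, ← Finset.sum_add_distrib, ← Finset.sum_sub_distrib]
    refine Finset.sum_congr rfl fun i _ => ?_
    rw [Finset.mul_sum, ← Finset.sum_add_distrib, ← Finset.sum_sub_distrib]
    refine Finset.sum_congr rfl fun j _ => ?_
    ring
  have h5 : ‖y - x‖ ^ 2 * ‖z - x‖ ^ 2 - (inner ℝ (y - x) (z - x)) ^ 2 =
      ‖triBivector x y z‖ ^ 2 / 2 := by rw [key]; ring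
  rw [triArea, h5, Real.sqrt_div (sq_nonneg _), Real.sqrt_sq (norm_nonneg _), div_div, mul_comm]

/-- The standard `2`-metric on `ℝⁿ`: the area of the triangle spanned by three points. -/
noncomputable def areaTwoMetric (n : ℕ) : TwoMetric (EuclideanSpace ℝ (Fin n)) where
  dist := triArea
  symm_left x y z := by
    have h : triBivector y x z = -triBivector x y z := by
      ext p; simp only [triBivector, PiLp.neg_apply]; ring
    rw [triArea_eq_norm, triArea_eq_norm, h, norm_neg]
  symm_right x y z := by
    have h : triBivector x z y = -triBivector x y z := by
      ext p; simp only [triBivector, PiLp.neg_apply]; ring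
    rw [triArea_eq_norm, triArea_eq_norm, h, norm_neg]
  zero x y := by simp [triArea]
  tetrahedral x y z w := by
    have h : triBivector x y w = triBivector x y z - triBivector y z w + triBivector x z w := by
      ext p; simp only [triBivector, PiLp.add_apply, PiLp.sub_apply]; ring
    simp only [triArea_eq_norm]
    rw [← add_div, ← add_div, h]
    have h1 := norm_add_le (triBivector x y z - triBivector y z w) (triBivector x z w)
    have h2 := norm_sub_le (triBivector x y z) (triBivector y z w)
    gcongr
    linarith

/-- The AC structure of `ℝⁿ` with its standard area `2`-metric. -/
noncomputable def areaAC (n : ℕ) : ACStructure (Coarse (EuclideanSpace ℝ (Fin n))) :=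
  (areaTwoMetric n).toAC

/-! ### Piecewise linear paths -/

/-- The piecewise linear path, parametrized by `[0, 1]`, which runs through the points
`p₀, …, pₖ` of the list along straight segments, each of them in time `1 / k`
(the constant path if `k = 0`). -/
noncomputable def polyline {E : Type u} [AddCommGroup E] [Module ℝ E] (p : List E) (t : ℝ) : E :=
  AffineMap.lineMap (p.getD ⌊((p.length - 1 : ℕ) : ℝ) * t⌋₊ 0)
    (p.getD (⌊((p.length - 1 : ℕ) : ℝ) * t⌋₊ + 1) 0) (Int.fract (((p.length - 1 : ℕ) : ℝ) * t))

/-- Two parametrized paths `[0, 1] → E` agree up to (weakly monotone) reparametrization. -/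
def SamePath {E : Type u} (p q : ℝ → E) : Prop :=
  ∃ α β : ℝ → ℝ,
    (ContinuousOn α (Icc 0 1) ∧ MonotoneOn α (Icc 0 1) ∧ α 0 = 0 ∧ α 1 = 1) ∧
    (ContinuousOn β (Icc 0 1) ∧ MonotoneOn β (Icc 0 1) ∧ β 0 = 0 ∧ β 1 = 1) ∧
    ∀ t ∈ Icc (0 : ℝ) 1, p (α t) = q (β t)

/-- The points `x₀, …, xₖ` passed by an arrow of the free category on the coarse graph of `E`. -/
def pathPoints {E : Type u} {x y : Paths (Coarse E)} (f : x ⟶ y) : List E :=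
  (Quiver.Path.vertices (V := Coarse E) f).map Coarse.pt

/-- The closed path `g⁻¹ f`: first along `f`, then back along `g`. -/
noncomputable def loopPath {E : Type u} [AddCommGroup E] [Module ℝ E] {x y : Paths (Coarse E)}
    (f g : x ⟶ y) : ℝ → E :=
  polyline (pathPoints f ++ (pathPoints g).reverse.tail)

/-! ### Piecewise linear disks -/

/-- Twice the signed area of the triangle `p q r` in the plane. -/
def orient (p q r : EuclideanSpace ℝ (Fin 2)) : ℝ :=
  (q 0 - p 0) * (r 1 - p 1) - (q 1 - p 1) * (r 0 - p 0)

/-- A piecewise linear map `s` from a compact convex polygonal region `D ⊆ ℝ²` to `ℝⁿ`.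
The region is given by distinct points `vertex 0, …, vertex (m - 1)` on its boundary, listed in
counterclockwise order and including all corners (some of the points may lie in the interior of an
edge), so that `D` is their convex hull and `∂D` is the closed polygonal path through them.
The map comes with a division of `D` into triangles on each of which it is affine. -/
structure PLDisk (n : ℕ) where
  m : ℕ
  vertex : Fin m → EuclideanSpace ℝ (Fin 2)
  vertex_injective : Function.Injective vertex
  counterclockwise : ∀ i j k : Fin m, i < j → j < k → 0 ≤ orient (vertex i) (vertex j) (vertex k)
  interior_nonempty : (interior (convexHull ℝ (range vertex))).Nonempty
  map : EuclideanSpace ℝ (Fin 2) → EuclideanSpace ℝ (Fin n)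
  N : ℕ
  tri : Fin N → Fin 3 → EuclideanSpace ℝ (Fin 2)
  tri_nondegenerate : ∀ i, AffineIndependent ℝ (tri i)
  tri_disjoint : ∀ i j, i ≠ j →
    Disjoint (interior (convexHull ℝ (range (tri i)))) (interior (convexHull ℝ (range (tri j))))
  tri_cover : ⋃ i, convexHull ℝ (range (tri i)) = convexHull ℝ (range vertex)
  map_affine : ∀ i, ∃ A : EuclideanSpace ℝ (Fin 2) →ᵃ[ℝ] EuclideanSpace ℝ (Fin n),
    EqOn map A (convexHull ℝ (range (tri i)))

namespace PLDisk

/-- The boundary `∂D`, traversed once counterclockwise from `vertex 0` back to `vertex 0`. -/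
noncomputable def domainBoundary {n : ℕ} (D : PLDisk n) : ℝ → EuclideanSpace ℝ (Fin 2) :=
  polyline (List.ofFn D.vertex ++ (List.ofFn D.vertex).take 1)

/-- The boundary `∂s` of the map, a closed path in `ℝⁿ`. -/
noncomputable def boundary {n : ℕ} (D : PLDisk n) : ℝ → EuclideanSpace ℝ (Fin n) :=
  fun t => D.map (D.domainBoundary t)

/-- `Area(D, s)`: the sum of the areas of the images of the triangles
(this does not depend on the chosen division into triangles). -/
noncomputable def area {n : ℕ} (D : PLDisk n) : ℝ :=
  ∑ i, triArea (D.map (D.tri i 0)) (D.map (D.tri i 1)) (D.map (D.tri i 2))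

end PLDisk

/-- The areas of the piecewise linear disks whose boundary is the closed path `a`. -/
def fillingAreas {n : ℕ} (a : ℝ → EuclideanSpace ℝ (Fin n)) : Set ℝ :=
  {r | ∃ D : PLDisk n, SamePath D.boundary a ∧ r = D.area}

/-- `MinArea(a)`: the infimum of the areas of piecewise linear disks with boundary `a`. -/
noncomputable def minArea {n : ℕ} (a : ℝ → EuclideanSpace ℝ (Fin n)) : ℝ :=
  sInf (fillingAreas a)

/-- `d_Area(f, g) = MinArea(g⁻¹ f)` for piecewise linear paths `f`, `g` from `x` to `y`. -/
noncomputable def dArea {n : ℕ} ⦃x y : Paths (Coarse (EuclideanSpace ℝ (Fin n)))⦄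
    (f g : x ⟶ y) : ℝ :=
  minArea (loopPath f g)

/-! ### Elementary facts about triangle areas -/

/-! Besides `dMax` and `dArea` there is a third distance, `htpyDist`: the infimal cost of deforming
one polygonal path into another by repeating a vertex, dropping a repetition, or moving one inner
vertex at the price of the two triangles it sweeps. The proof closes the circle `dMax` ≤ `dArea` ≤
`htpyDist` ≤ `dMax`.

The last inequality holds because `htpyDist` is itself a functorial distance
(`isFunctorialDistance_htpyDist`). For the middle one, a deformation is drawn on a rectangular grid:
the rows are the successive paths, padded to a common length, the outer columns are constant, and
the grid triangles have total image area equal to the cost (`SeqHtpy.exists_grid`, `area_gridDisk`,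
`samePath_gridDisk`, `ListHtpy.mem_fillingAreas`).

The first inequality compares an arbitrary functorial distance with an arbitrary disk. After
identifying arrows at distance zero, every arrow is invertible, because going from x to y and back
spans no area. The distance becomes a conjugation invariant length on a vertex group, for which a
triangle boundary is at most as long as the triangle's area
(`IsFunctorialDistance.exists_areaLength`). In this group a piecewise straight curve has a
well-defined product of steps, since subdividing a straight piece only inserts degenerate triangles
(`Trav.unique`), and the product survives reparametrization. Over the domain of a disk, the loop
around a planar triangle is a product of conjugates of the loops around the two halves of a cut
(`PLDisk.len_loop_split`). Cutting along the lines that carry the sides of the given division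
reduces to triangles inside one affine piece, so every such loop is bounded by its image area
(`PLDisk.len_loop_le`). A fan of diagonals then bounds the whole boundary of the convex domain
(`PLDisk.len_listProd_le`). Areas are added as planar Lebesgue measure weighted by the scaling
factor of each affine piece, so no common refinement of divisions is needed.

The value on a single triangle follows from a calibration: the bivector swept out from the origin is
additive under composition, so its norm gives a functorial distance attaining the triangle area
(`isFunctorialDistance_sweptDist`). -/

theorem triArea_nonneg {n : ℕ} (x y z : EuclideanSpace ℝ (Fin n)) : 0 ≤ triArea x y z := by
  unfold triArea; positivity

theorem triArea_swap_left {n : ℕ} (x y z : EuclideanSpace ℝ (Fin n)) :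
    triArea x y z = triArea y x z := (areaTwoMetric n).symm_left x y z

theorem triArea_swap_right {n : ℕ} (x y z : EuclideanSpace ℝ (Fin n)) :
    triArea x y z = triArea x z y := (areaTwoMetric n).symm_right x y z

@[simp] theorem triArea_self_left {n : ℕ} (x y : EuclideanSpace ℝ (Fin n)) :
    triArea x x y = 0 := (areaTwoMetric n).zero x y

@[simp] theorem triArea_self_right {n : ℕ} (x y : EuclideanSpace ℝ (Fin n)) :
    triArea x y y = 0 := by
  rw [triArea_swap_left, triArea_swap_right, triArea_self_left]

@[simp] theorem triArea_self_outer {n : ℕ} (x y : EuclideanSpace ℝ (Fin n)) :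
    triArea x y x = 0 := by
  rw [triArea_swap_right, triArea_self_left]

/-! ### The points of a path -/

section pathPoints

variable {E : Type u}

theorem pathPoints_id (x : Paths (Coarse E)) : pathPoints (𝟙 x) = [Coarse.pt x] := rfl

theorem pathPoints_of {x y : Coarse E} (f : x ⟶ y) :
    pathPoints ((Paths.of (Coarse E)).map f) = [x.pt, y.pt] := rfl

theorem pathPoints_comp {x y z : Paths (Coarse E)} (f : x ⟶ y) (g : y ⟶ z) :
    pathPoints (f ≫ g) = (pathPoints f).dropLast ++ pathPoints g := by
  unfold pathPoints
  rw [← List.map_dropLast, ← List.map_append]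
  exact congrArg _ (Quiver.Path.vertices_comp (V := Coarse E) f g)

theorem dropLast_pathPoints {x y : Paths (Coarse E)} (f : x ⟶ y) :
    (pathPoints f).dropLast ++ [Coarse.pt y] = pathPoints f := by
  unfold pathPoints
  rw [← List.map_dropLast]
  have h := congrArg (List.map Coarse.pt)
    (Quiver.Path.dropLast_append_end_eq (V := Coarse E) f)
  rw [List.map_append] at h
  exact h

theorem head_pathPoints {x y : Paths (Coarse E)} (f : x ⟶ y) :
    (pathPoints f).head? = some (Coarse.pt x) := by
  unfold pathPoints
  rw [List.head?_map]
  erw [Quiver.Path.vertices_head? (V := Coarse E) f]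
  rfl

theorem pathPoints_eq_cons {x y : Paths (Coarse E)} (f : x ⟶ y) :
    pathPoints f = Coarse.pt x :: (pathPoints f).tail := by
  have h := head_pathPoints f
  cases hp : pathPoints f with
  | nil => simp [hp] at h
  | cons a l => simp [hp] at h; simp [h]

theorem pathPoints_comp' {x y z : Paths (Coarse E)} (f : x ⟶ y) (g : y ⟶ z) :
    pathPoints (f ≫ g) = pathPoints f ++ (pathPoints g).tail := by
  rw [pathPoints_comp, pathPoints_eq_cons g, List.tail_cons, ← dropLast_pathPoints f]
  simp

/-- The unique arrow between two points of the coarse graph, as a path. -/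
def straightPath (x y : Paths (Coarse E)) : x ⟶ y :=
  (Paths.of (Coarse E)).map (X := x) (Y := y) ()

theorem path_induction {x : Paths (Coarse E)} (P : ∀ y : Paths (Coarse E), (x ⟶ y) → Prop)
    (nil : P x (𝟙 x))
    (cons : ∀ (y z : Paths (Coarse E)) (f : x ⟶ y), P y f → P z (f ≫ straightPath y z))
    {y : Paths (Coarse E)} (f : x ⟶ y) : P y f := by
  refine Paths.induction_fixed_source (fun {b} g => P b g) nil (fun {u v} p q h => ?_) f
  exact cons u v p h

end pathPoints

/-! ### Elementary homotopies of lists of points -/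

/-- `ListHtpy p q c`: the polygonal path `q` is obtained from `p` by stalling at points and moving
inner points, where moving `a` to `b` between neighbours `x` and `z` costs
`triArea x a b + triArea a b z`, with total cost `c`. -/
inductive ListHtpy {n : ℕ} :
    List (EuclideanSpace ℝ (Fin n)) → List (EuclideanSpace ℝ (Fin n)) → ℝ → Prop
  | refl (p) : ListHtpy p p 0
  | stall (l x r) : ListHtpy (l ++ x :: r) (l ++ x :: x :: r) 0
  | unstall (l x r) : ListHtpy (l ++ x :: x :: r) (l ++ x :: r) 0
  | change (l x a b z r) : ListHtpy (l ++ x :: a :: z :: r) (l ++ x :: b :: z :: r)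
      (triArea x a b + triArea a b z)
  | trans {p q r c c'} : ListHtpy p q c → ListHtpy q r c' → ListHtpy p r (c + c')

namespace ListHtpy

variable {n : ℕ} {p q r : List (EuclideanSpace ℝ (Fin n))} {c c' : ℝ}

theorem nonneg (h : ListHtpy p q c) : 0 ≤ c := by
  induction h with
  | refl | stall | unstall => exact le_rfl
  | change l x a b z r => exact add_nonneg (triArea_nonneg _ _ _) (triArea_nonneg _ _ _)
  | trans _ _ h1 h2 => exact add_nonneg h1 h2

theorem symm (h : ListHtpy p q c) : ListHtpy q p c := by
  induction h with
  | refl p => exact .refl p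
  | stall l x r => exact .unstall l x r
  | unstall l x r => exact .stall l x r
  | change l x a b z r =>
    rw [triArea_swap_right x a b, triArea_swap_left a b z]
    exact .change l x b a z r
  | trans _ _ h1 h2 => rw [add_comm]; exact h2.trans h1

theorem append_left (s : List (EuclideanSpace ℝ (Fin n))) (h : ListHtpy p q c) :
    ListHtpy (s ++ p) (s ++ q) c := by
  induction h with
  | refl p => exact .refl _
  | stall l x r => simpa using ListHtpy.stall (s ++ l) x r
  | unstall l x r => simpa using ListHtpy.unstall (s ++ l) x r
  | change l x a b z r => simpa using ListHtpy.change (s ++ l) x a b z r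
  | trans _ _ h1 h2 => exact h1.trans h2

theorem append_right (s : List (EuclideanSpace ℝ (Fin n))) (h : ListHtpy p q c) :
    ListHtpy (p ++ s) (q ++ s) c := by
  induction h with
  | refl p => exact .refl _
  | stall l x r => simpa using ListHtpy.stall l x (r ++ s)
  | unstall l x r => simpa using ListHtpy.unstall l x (r ++ s)
  | change l x a b z r => simpa using ListHtpy.change l x a b z (r ++ s)
  | trans _ _ h1 h2 => exact h1.trans h2

/-- Moving `y` onto its neighbour `x` sweeps only one nondegenerate triangle, and the repetition of
`x` is then dropped for free. -/
theorem remove (l r : List (EuclideanSpace ℝ (Fin n))) (x y z : EuclideanSpace ℝ (Fin n)) :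
    ListHtpy (l ++ x :: y :: z :: r) (l ++ x :: z :: r) (triArea x y z) := by
  have h := (ListHtpy.change l x y x z r).trans (.unstall l x (z :: r))
  simpa [triArea_swap_left y x z] using h

/-- Inner vertices are removed one at a time, which triangulates the path as a fan from its starting
point. Hence any two parallel paths are connected by a homotopy and the infimum in `htpyDist` is
over a nonempty set. -/
theorem exists_straight {x y : Paths (Coarse (EuclideanSpace ℝ (Fin n)))} (f : x ⟶ y) :
    ∃ c, ListHtpy (pathPoints f) [Coarse.pt x, Coarse.pt y] c := by
  refine path_induction (x := x)
    (fun y f => ∃ c, ListHtpy (pathPoints f) [Coarse.pt x, Coarse.pt y] c)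
    ⟨0, ListHtpy.stall [] (Coarse.pt x) []⟩ ?_ f
  rintro y z f ⟨c, hc⟩
  refine ⟨c + triArea (Coarse.pt x) (Coarse.pt y) (Coarse.pt z), ?_⟩
  rw [pathPoints_comp']
  exact (hc.append_right _).trans (remove [] [] _ _ _)

theorem exists_htpy {x y : Paths (Coarse (EuclideanSpace ℝ (Fin n)))} (f g : x ⟶ y) :
    ∃ c, ListHtpy (pathPoints f) (pathPoints g) c := by
  obtain ⟨c, hc⟩ := exists_straight f
  obtain ⟨c', hc'⟩ := exists_straight g
  exact ⟨_, hc.trans hc'.symm⟩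

end ListHtpy

/-- The infimal cost of an elementary homotopy between two paths. -/
noncomputable def htpyDist {n : ℕ} ⦃x y : Paths (Coarse (EuclideanSpace ℝ (Fin n)))⦄
    (f g : x ⟶ y) : ℝ :=
  sInf {c | ListHtpy (pathPoints f) (pathPoints g) c}

section htpyDist

variable {n : ℕ} {x y z : Paths (Coarse (EuclideanSpace ℝ (Fin n)))}

theorem htpyDist_le {f g : x ⟶ y} {c : ℝ} (h : ListHtpy (pathPoints f) (pathPoints g) c) :
    htpyDist f g ≤ c :=
  csInf_le ⟨0, fun _ h => h.nonneg⟩ h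

theorem le_htpyDist {f g : x ⟶ y} {a : ℝ}
    (h : ∀ c, ListHtpy (pathPoints f) (pathPoints g) c → a ≤ c) : a ≤ htpyDist f g :=
  le_csInf (ListHtpy.exists_htpy f g) h

theorem htpyDist_nonneg (f g : x ⟶ y) : 0 ≤ htpyDist f g := le_htpyDist fun _ h => h.nonneg

/-- Homotopies can be reversed and concatenated, which gives the pseudometric. For composition, the
first factor is deformed while the second stays fixed, then the second is deformed. -/
theorem isFunctorialDistance_htpyDist : IsFunctorialDistance (areaAC n) htpyDist where
  self f := le_antisymm (htpyDist_le (.refl _)) (htpyDist_nonneg f f)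
  symm f g := le_antisymm (le_htpyDist fun _ h => htpyDist_le h.symm)
    (le_htpyDist fun _ h => htpyDist_le h.symm)
  triangle f g h := by
    rw [← sub_le_iff_le_add]
    refine le_htpyDist fun c hc => ?_
    rw [sub_le_comm]
    refine le_htpyDist fun c' hc' => ?_
    rw [sub_le_iff_le_add']
    simpa [add_comm] using htpyDist_le (hc.trans hc')
  comp_le f f' g g' := by
    rw [← sub_le_iff_le_add]
    refine le_htpyDist fun c hc => ?_
    rw [sub_le_comm]
    refine le_htpyDist fun c' hc' => ?_
    rw [sub_le_iff_le_add']
    refine htpyDist_le ?_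
    have h1 := hc.append_right (pathPoints g).tail
    have h2 := hc'.append_left (pathPoints f').dropLast
    rw [← pathPoints_comp'] at h1
    rw [← pathPoints_comp, ← pathPoints_comp, pathPoints_comp'] at h2
    exact h1.trans h2
  le_d {x y z} f g h := htpyDist_le (ListHtpy.remove [] [] x.pt y.pt z.pt)
  unit x := le_antisymm (htpyDist_le (ListHtpy.unstall [] x.pt [])) (htpyDist_nonneg _ _)

end htpyDist

/-! ### The largest functorial distance -/

section dMax

variable {n : ℕ}

theorem IsPseudoMetrized.nonneg {C : Type u} [Category.{v} C]
    {φ : ∀ ⦃x y : C⦄, (x ⟶ y) → (x ⟶ y) → ℝ} (hφ : IsPseudoMetrized C φ) {x y : C} (f g : x ⟶ y) :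
    0 ≤ φ f g := by
  have h := hφ.triangle f f g
  rw [hφ.self, hφ.symm g f] at h
  linarith

/-- The bound is the total area of the fan of triangles from the starting point. It does not depend
on `φ`, and this makes the supremum `dMax` finite. -/
theorem IsFunctorialDistance.exists_bound (n : ℕ) {x y : Paths (Coarse (EuclideanSpace ℝ (Fin n)))}
    (f : x ⟶ y) : ∃ c, ∀ φ : ∀ ⦃x y : Paths (Coarse (EuclideanSpace ℝ (Fin n)))⦄,
      (x ⟶ y) → (x ⟶ y) → ℝ, IsFunctorialDistance (areaAC n) φ → φ f (straightPath x y) ≤ c := by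
  refine path_induction (fun y f => ∃ c, ∀ φ : ∀ ⦃x y : Paths (Coarse (EuclideanSpace ℝ (Fin n)))⦄,
      (x ⟶ y) → (x ⟶ y) → ℝ, IsFunctorialDistance (areaAC n) φ → φ f (straightPath x y) ≤ c)
    ⟨0, fun φ hφ => ?_⟩ ?_ f
  · rw [hφ.symm]; exact (hφ.unit x).le
  · rintro y z f ⟨c, hc⟩
    refine ⟨c + (areaAC n).d (x := x) (y := y) (z := z) () () (), fun φ hφ => ?_⟩
    have h1 := hφ.comp_le f (straightPath x y) (straightPath y z) (straightPath y z)
    have h2 := hφ.triangle (f ≫ straightPath y z) (straightPath x z)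
      (straightPath x y ≫ straightPath y z)
    have h3 : φ (straightPath x y ≫ straightPath y z) (straightPath x z) ≤ _ :=
      hφ.le_d (x := x) (y := y) (z := z) () () ()
    rw [hφ.self] at h1
    have h4 := hc φ hφ
    linarith

theorem bddAbove_functorialDistance {x y : Paths (Coarse (EuclideanSpace ℝ (Fin n)))}
    (f g : x ⟶ y) :
    BddAbove {r : ℝ | ∃ φ : ∀ ⦃x y : Paths (Coarse (EuclideanSpace ℝ (Fin n)))⦄,
      (x ⟶ y) → (x ⟶ y) → ℝ, IsFunctorialDistance (areaAC n) φ ∧ r = φ f g} := by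
  obtain ⟨c, hc⟩ := IsFunctorialDistance.exists_bound n f
  obtain ⟨c', hc'⟩ := IsFunctorialDistance.exists_bound n g
  refine ⟨c + c', ?_⟩
  rintro _ ⟨φ, hφ, rfl⟩
  have h := hφ.triangle f g (straightPath x y)
  have h1 := hc φ hφ
  have h2 := hc' φ hφ
  rw [hφ.symm g] at h2
  linarith

theorem le_dMax {φ : ∀ ⦃x y : Paths (Coarse (EuclideanSpace ℝ (Fin n)))⦄,
      (x ⟶ y) → (x ⟶ y) → ℝ} (hφ : IsFunctorialDistance (areaAC n) φ)
    {x y : Paths (Coarse (EuclideanSpace ℝ (Fin n)))} (f g : x ⟶ y) :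
    φ f g ≤ dMax (areaAC n) f g :=
  le_csSup (bddAbove_functorialDistance f g) ⟨φ, hφ, rfl⟩

theorem dMax_le {x y : Paths (Coarse (EuclideanSpace ℝ (Fin n)))} {f g : x ⟶ y} {c : ℝ}
    (h : ∀ φ : ∀ ⦃x y : Paths (Coarse (EuclideanSpace ℝ (Fin n)))⦄,
      (x ⟶ y) → (x ⟶ y) → ℝ, IsFunctorialDistance (areaAC n) φ → φ f g ≤ c) :
    dMax (areaAC n) f g ≤ c := by
  refine csSup_le ⟨_, htpyDist, isFunctorialDistance_htpyDist, rfl⟩ ?_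
  rintro _ ⟨φ, hφ, rfl⟩
  exact h φ hφ

/-- Each axiom is an upper bound by terms monotone in `φ`, so it passes to the supremum. Where an
equality with zero is required, `htpyDist` supplies the lower bound. -/
theorem isFunctorialDistance_dMax : IsFunctorialDistance (areaAC n) (dMax (areaAC n)) where
  self f := le_antisymm (dMax_le fun _ hφ => (hφ.self f).le)
    ((htpyDist_nonneg f f).trans (le_dMax isFunctorialDistance_htpyDist f f))
  symm f g := le_antisymm (dMax_le fun _ hφ => (hφ.symm f g).trans_le (le_dMax hφ g f))
    (dMax_le fun _ hφ => (hφ.symm g f).trans_le (le_dMax hφ f g))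
  triangle f g h := dMax_le fun _ hφ =>
    (hφ.triangle f g h).trans (add_le_add (le_dMax hφ _ _) (le_dMax hφ _ _))
  comp_le f f' g g' := dMax_le fun _ hφ =>
    (hφ.comp_le f f' g g').trans (add_le_add (le_dMax hφ _ _) (le_dMax hφ _ _))
  le_d f g h := dMax_le fun _ hφ => hφ.le_d f g h
  unit x := le_antisymm (dMax_le fun _ hφ => (hφ.unit x).le)
    ((htpyDist_nonneg _ _).trans (le_dMax isFunctorialDistance_htpyDist _ _))

end dMax

/-! ### The area of a triangle bounds every filling from below -/

/-- The bivector swept out from the origin by a polygonal path. -/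
noncomputable def sweptBivector {n : ℕ} :
    List (EuclideanSpace ℝ (Fin n)) → EuclideanSpace ℝ (Fin n × Fin n)
  | [] => 0
  | [_] => 0
  | x :: y :: l => triBivector 0 x y + sweptBivector (y :: l)

theorem sweptBivector_append {n : ℕ} (l r : List (EuclideanSpace ℝ (Fin n)))
    (x : EuclideanSpace ℝ (Fin n)) :
    sweptBivector (l ++ x :: r) = sweptBivector (l ++ [x]) + sweptBivector (x :: r) := by
  induction l with
  | nil => simp [sweptBivector]
  | cons a l ih =>
    cases l with
    | nil => simp [sweptBivector]
    | cons b l =>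
      simp only [List.cons_append, sweptBivector] at ih ⊢
      rw [ih, add_assoc]

theorem sweptBivector_comp {n : ℕ} {x y z : Paths (Coarse (EuclideanSpace ℝ (Fin n)))}
    (f : x ⟶ y) (g : y ⟶ z) : sweptBivector (pathPoints (f ≫ g)) =
      sweptBivector (pathPoints f) + sweptBivector (pathPoints g) := by
  rw [pathPoints_comp, pathPoints_eq_cons g, sweptBivector_append, dropLast_pathPoints]

/-- The contributions of the origin cancel around a closed path, leaving the bivector of the
triangle itself. -/
theorem norm_sweptBivector_triangle {n : ℕ} (x y z : EuclideanSpace ℝ (Fin n)) :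
    ‖sweptBivector [x, y, z] - sweptBivector [x, z]‖ / (2 * √2) = triArea x y z := by
  rw [triArea_eq_norm]
  congr 2
  ext p
  simp only [sweptBivector, triBivector, PiLp.add_apply, PiLp.sub_apply, PiLp.zero_apply]
  ring

/-- The distance between the bivectors swept out by two paths. -/
noncomputable def sweptDist {n : ℕ} ⦃x y : Paths (Coarse (EuclideanSpace ℝ (Fin n)))⦄
    (f g : x ⟶ y) : ℝ :=
  ‖sweptBivector (pathPoints f) - sweptBivector (pathPoints g)‖ / (2 * √2)

/-- Additivity of the swept bivector under composition reduces the axioms to the triangle inequality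
of the norm. -/
theorem isFunctorialDistance_sweptDist (n : ℕ) :
    IsFunctorialDistance (areaAC n) sweptDist where
  self f := by simp [sweptDist]
  symm f g := by rw [sweptDist, norm_sub_rev, sweptDist]
  triangle f g h := by
    rw [sweptDist, sweptDist, sweptDist, ← add_div]
    gcongr
    exact norm_sub_le_norm_sub_add_norm_sub _ _ _
  comp_le f f' g g' := by
    rw [sweptDist, sweptDist, sweptDist, ← add_div, sweptBivector_comp, sweptBivector_comp, add_sub_add_comm]
    gcongr
    exact norm_add_le _ _
  le_d {x y z} f g h := by
    have h1 := norm_sweptBivector_triangle x.pt y.pt z.pt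
    rw [sweptDist, pathPoints_comp', pathPoints_of, pathPoints_of, pathPoints_of]
    exact h1.le
  unit x := by
    have h : triBivector 0 x.pt x.pt = 0 := by
      ext p
      simp only [triBivector, PiLp.zero_apply]
      ring
    rw [sweptDist, pathPoints_of, pathPoints_id]
    simp [sweptBivector, h]

theorem triArea_eq_dMax {n : ℕ} {x y z : Coarse (EuclideanSpace ℝ (Fin n))}
    (f : x ⟶ y) (g : y ⟶ z) (h : x ⟶ z) :
    triArea x.pt y.pt z.pt = dMax (areaAC n)
      ((Paths.of (Coarse (EuclideanSpace ℝ (Fin n)))).map f ≫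
        (Paths.of (Coarse (EuclideanSpace ℝ (Fin n)))).map g)
      ((Paths.of (Coarse (EuclideanSpace ℝ (Fin n)))).map h) := by
  refine le_antisymm ?_ (isFunctorialDistance_dMax.le_d f g h)
  have h1 := le_dMax (isFunctorialDistance_sweptDist n)
      ((Paths.of (Coarse (EuclideanSpace ℝ (Fin n)))).map f ≫
        (Paths.of (Coarse (EuclideanSpace ℝ (Fin n)))).map g)
      ((Paths.of (Coarse (EuclideanSpace ℝ (Fin n)))).map h)
  rw [sweptDist, pathPoints_comp', pathPoints_of, pathPoints_of, pathPoints_of] at h1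
  exact (norm_sweptBivector_triangle x.pt y.pt z.pt).ge.trans h1

/-! ### Groups of paths with a length function controlled by area -/

/-- A group `G` generated by steps `e x y` between points of `ℝⁿ`, in which the boundaries of
degenerate triangles are trivial, with a conjugation invariant length function
for which the boundary of a triangle has length at most its area. -/
structure AreaLength (n : ℕ) (G : Type u) [Group G] where
  e : EuclideanSpace ℝ (Fin n) → EuclideanSpace ℝ (Fin n) → G
  len : G → ℝ
  e_self : ∀ x, e x x = 1
  e_mul : ∀ x y z, triArea x y z = 0 → e x y * e y z = e x z
  len_one : len 1 = 0
  len_mul_le : ∀ a b, len (a * b) ≤ len a + len b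
  len_conj : ∀ a b, len (a * b * a⁻¹) = len b
  len_inv : ∀ a, len a⁻¹ = len a
  len_triangle : ∀ x y z, len (e x y * e y z * e z x) ≤ triArea x y z

namespace AreaLength

variable {n : ℕ} {G : Type u} [Group G] (S : AreaLength n G)

/-- The triangle `x`, `y`, `x` is degenerate. -/
theorem e_symm (x y : EuclideanSpace ℝ (Fin n)) : S.e y x = (S.e x y)⁻¹ := by
  rw [eq_inv_iff_mul_eq_one, S.e_mul y x y (by simp), S.e_self]

/-- The product of the steps along a list of points. -/
def listProd : List (EuclideanSpace ℝ (Fin n)) → G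
  | [] => 1
  | [_] => 1
  | x :: y :: l => S.e x y * listProd (y :: l)

theorem listProd_append (l r : List (EuclideanSpace ℝ (Fin n))) (x : EuclideanSpace ℝ (Fin n)) :
    S.listProd (l ++ x :: r) = S.listProd (l ++ [x]) * S.listProd (x :: r) := by
  induction l with
  | nil => simp [listProd]
  | cons a l ih =>
    cases l with
    | nil => simp [listProd]
    | cons b l =>
      simp only [List.cons_append, listProd] at ih ⊢
      rw [ih, mul_assoc]

theorem listProd_reverse (l : List (EuclideanSpace ℝ (Fin n))) :
    S.listProd l.reverse = (S.listProd l)⁻¹ := by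
  induction l with
  | nil => simp [listProd]
  | cons a l ih =>
    cases l with
    | nil => simp [listProd]
    | cons b l =>
      rw [List.reverse_cons, List.reverse_cons, List.append_assoc, List.singleton_append,
        listProd_append, ← List.reverse_cons, ih]
      simp [listProd, S.e_symm a b]

/-- The product of the first `k` steps along a sequence. -/
def seqProd (g : ℕ → ℕ → G) : ℕ → G
  | 0 => 1
  | k + 1 => seqProd g k * g k (k + 1)

theorem seqProd_succ' (g : ℕ → ℕ → G) (k : ℕ) :
    seqProd g (k + 1) = g 0 1 * seqProd (fun i j => g (i + 1) (j + 1)) k := by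
  induction k with
  | zero => simp [seqProd]
  | succ k ih => rw [seqProd, ih, seqProd, mul_assoc]

theorem listProd_eq_seqProd (l : List (EuclideanSpace ℝ (Fin n))) :
    S.listProd l = seqProd (fun i j => S.e (l.getD i 0) (l.getD j 0)) (l.length - 1) := by
  induction l with
  | nil => simp [listProd, seqProd]
  | cons a l ih =>
    cases l with
    | nil => simp [listProd, seqProd]
    | cons b l =>
      rw [listProd, ih]
      simp only [List.length_cons, Nat.add_sub_cancel]
      rw [seqProd_succ']
      rfl

end AreaLength

/-! ### Products along piecewise straight curves -/

/-- The curve `γ` maps `[a, b]` into a line. -/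
def StraightOn {E : Type u} [AddCommGroup E] [Module ℝ E] (γ : ℝ → E) (a b : ℝ) : Prop :=
  ∃ x v : E, ∀ t ∈ Icc a b, ∃ c : ℝ, γ t = x + c • v

theorem StraightOn.mono {E : Type u} [AddCommGroup E] [Module ℝ E] {γ : ℝ → E} {a b a' b' : ℝ}
    (h : StraightOn γ a b) (ha : a ≤ a') (hb : b' ≤ b) : StraightOn γ a' b' := by
  obtain ⟨x, v, h⟩ := h
  exact ⟨x, v, fun t ht => h t ⟨ha.trans ht.1, ht.2.trans hb⟩⟩

theorem StraightOn.triArea_eq_zero {n : ℕ} {γ : ℝ → EuclideanSpace ℝ (Fin n)} {a b : ℝ}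
    (h : StraightOn γ a b) {r s t : ℝ} (hr : r ∈ Icc a b) (hs : s ∈ Icc a b) (ht : t ∈ Icc a b) :
    triArea (γ r) (γ s) (γ t) = 0 := by
  obtain ⟨x, v, h⟩ := h
  obtain ⟨c1, h1⟩ := h r hr
  obtain ⟨c2, h2⟩ := h s hs
  obtain ⟨c3, h3⟩ := h t ht
  have h0 : triBivector (γ r) (γ s) (γ t) = 0 := by
    ext p
    simp only [triBivector, h1, h2, h3, PiLp.add_apply, PiLp.smul_apply, smul_eq_mul,
      PiLp.zero_apply]
    ring
  rw [triArea_eq_norm, h0]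
  simp

theorem straightOn_lineMap {E : Type u} [AddCommGroup E] [Module ℝ E] (x y : E) (a b : ℝ) :
    StraightOn (AffineMap.lineMap x y : ℝ → E) a b :=
  ⟨x, y - x, fun t _ => ⟨t, by rw [AffineMap.lineMap_apply, vsub_eq_sub, vadd_eq_add, add_comm]⟩⟩

/-- `Trav S γ a b g`: the curve `γ` is piecewise straight on `[a, b]`, and `g` is the product of
the steps along the pieces. -/
inductive Trav {n : ℕ} {G : Type u} [Group G] (S : AreaLength n G)
    (γ : ℝ → EuclideanSpace ℝ (Fin n)) : ℝ → ℝ → G → Prop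
  | straight {a b : ℝ} : a ≤ b → StraightOn γ a b → Trav S γ a b (S.e (γ a) (γ b))
  | trans {a b c : ℝ} {g h : G} : Trav S γ a b g → Trav S γ b c h → Trav S γ a c (g * h)

namespace Trav

variable {n : ℕ} {G : Type u} [Group G] {S : AreaLength n G}
  {γ γ' : ℝ → EuclideanSpace ℝ (Fin n)} {a b c d : ℝ} {g h : G}

theorem le (ht : Trav S γ a b g) : a ≤ b := by
  induction ht with
  | straight h _ => exact h
  | trans _ _ h1 h2 => exact h1.trans h2

theorem refl (S : AreaLength n G) (γ : ℝ → EuclideanSpace ℝ (Fin n)) (a : ℝ) :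
    Trav S γ a a 1 := by
  have h : Trav S γ a a _ := .straight le_rfl
    ⟨γ a, 0, fun t ht => ⟨0, by rw [le_antisymm ht.2 ht.1]; simp⟩⟩
  rwa [S.e_self] at h

/-- A cut inside a straight piece replaces one step by two whose triangle is degenerate, so the
product does not change. -/
theorem split (ht : Trav S γ a b g) (hc : c ∈ Icc a b) :
    ∃ g₁ g₂, Trav S γ a c g₁ ∧ Trav S γ c b g₂ ∧ g = g₁ * g₂ := by
  induction ht with
  | @straight a b hab hs =>
    refine ⟨_, _, .straight hc.1 (hs.mono le_rfl hc.2), .straight hc.2 (hs.mono hc.1 le_rfl), ?_⟩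
    rw [S.e_mul _ _ _ (hs.triArea_eq_zero ⟨le_rfl, hab⟩ hc ⟨hab, le_rfl⟩)]
  | @trans a m b g h t1 t2 ih1 ih2 =>
    rcases le_total c m with hm | hm
    · obtain ⟨g1, g2, h1, h2, rfl⟩ := ih1 ⟨hc.1, hm⟩
      exact ⟨g1, g2 * h, h1, h2.trans t2, mul_assoc _ _ _⟩
    · obtain ⟨g1, g2, h1, h2, rfl⟩ := ih2 ⟨hm, hc.2⟩
      exact ⟨g * g1, g2, t1.trans h1, h2, (mul_assoc _ _ _).symm⟩

/-- Only collinearity of the image matters: the curve may run back and forth along the line, since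
any three of its points span no area. -/
theorem eq_of_straightOn (ht : Trav S γ a b g) (hs : StraightOn γ a b) :
    g = S.e (γ a) (γ b) := by
  induction ht with
  | straight => rfl
  | trans t1 t2 ih1 ih2 =>
    rw [ih1 (hs.mono le_rfl t2.le), ih2 (hs.mono t1.le le_rfl)]
    exact S.e_mul _ _ _ (hs.triArea_eq_zero ⟨le_rfl, t1.le.trans t2.le⟩ ⟨t1.le, t2.le⟩
      ⟨t1.le.trans t2.le, le_rfl⟩)

/-- Two subdivisions are compared by splitting the second at the break points of the first, after
which every piece is straight. -/
theorem unique (ht : Trav S γ a b g) (ht' : Trav S γ a b h) : g = h := by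
  induction ht generalizing h with
  | straight hab hs => exact (ht'.eq_of_straightOn hs).symm
  | trans t1 t2 ih1 ih2 =>
    obtain ⟨g1, g2, h1, h2, rfl⟩ := ht'.split ⟨t1.le, t2.le⟩
    rw [ih1 h1, ih2 h2]

/-- Break points are pulled back through `θ` by the intermediate value theorem. Monotonicity of `θ`
keeps each pulled back interval over its own straight piece; intervals on which `θ` is constant do
no harm. -/
theorem reparam (ht : Trav S γ c d g) {θ : ℝ → ℝ} (hab : a ≤ b) (hθ : ContinuousOn θ (Icc a b))
    (hm : MonotoneOn θ (Icc a b)) (ha : θ a = c) (hb : θ b = d)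
    (heq : ∀ t ∈ Icc a b, γ' t = γ (θ t)) : Trav S γ' a b g := by
  induction ht generalizing a b with
  | @straight c d hcd hs =>
    have h : Trav S γ' a b _ := .straight hab (by
      obtain ⟨x, v, hs⟩ := hs
      refine ⟨x, v, fun t ht => ?_⟩
      rw [heq t ht]
      refine hs _ ⟨?_, ?_⟩
      · rw [← ha]; exact hm ⟨le_rfl, hab⟩ ht ht.1
      · rw [← hb]; exact hm ht ⟨hab, le_rfl⟩ ht.2)
    rwa [heq a ⟨le_rfl, hab⟩, heq b ⟨hab, le_rfl⟩, ha, hb] at h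
  | @trans c m d g h t1 t2 ih1 ih2 =>
    have hmem : m ∈ Icc (θ a) (θ b) := by rw [ha, hb]; exact ⟨t1.le, t2.le⟩
    obtain ⟨t, ht, htm⟩ := intermediate_value_Icc hab hθ hmem
    have s1 : Icc a t ⊆ Icc a b := Icc_subset_Icc_right ht.2
    have s2 : Icc t b ⊆ Icc a b := Icc_subset_Icc_left ht.1
    exact (ih1 ht.1 (hθ.mono s1) (hm.mono s1) ha htm fun x hx => heq x (s1 hx)).trans
      (ih2 ht.2 (hθ.mono s2) (hm.mono s2) htm hb fun x hx => heq x (s2 hx))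

theorem reverse (ht : Trav S γ a b g) (heq : ∀ t, γ' (-t) = γ t) : Trav S γ' (-b) (-a) g⁻¹ := by
  induction ht with
  | @straight a b hab hs =>
    rw [← S.e_symm, ← heq, ← heq]
    refine .straight (neg_le_neg hab) ?_
    obtain ⟨x, v, hs⟩ := hs
    refine ⟨x, v, fun t ht => ?_⟩
    have h := hs (-t) ⟨by linarith [ht.2], by linarith [ht.1]⟩
    rwa [← heq, neg_neg] at h
  | trans t1 t2 ih1 ih2 =>
    rw [mul_inv_rev]
    exact ih2.trans ih1

end Trav

/-! ### Polygonal curves -/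

/-- The polygonal curve which runs through `w i` at time `i`. -/
noncomputable def plCurve {E : Type u} [AddCommGroup E] [Module ℝ E] (w : ℕ → E) (t : ℝ) : E :=
  AffineMap.lineMap (w ⌊t⌋₊) (w (⌊t⌋₊ + 1)) (Int.fract t)

/-- The closed interval is essential when pieces are glued: at the right end the floor has already
jumped, but the formulas of both pieces give the same vertex. -/
theorem plCurve_eq_lineMap {E : Type u} [AddCommGroup E] [Module ℝ E] (w : ℕ → E) {t : ℝ} (i : ℕ)
    (h : (i : ℝ) ≤ t) (h' : t ≤ i + 1) :
    plCurve w t = AffineMap.lineMap (w i) (w (i + 1)) (t - i) := by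
  rcases h'.eq_or_lt with rfl | h'
  · have h1 : ⌊(i : ℝ) + 1⌋₊ = i + 1 := by exact_mod_cast Nat.floor_natCast (R := ℝ) (i + 1)
    have h2 : Int.fract ((i : ℝ) + 1) = 0 := by
      exact_mod_cast Int.fract_natCast (R := ℝ) (i + 1)
    rw [plCurve, h1, h2]
    simp
  · have h1 : ⌊t⌋₊ = i := (Nat.floor_eq_iff ((Nat.cast_nonneg i).trans h)).2 ⟨h, h'⟩
    have h2 : Int.fract t = t - i := by
      rw [Int.fract_eq_iff]
      refine ⟨by linarith, by linarith, i, by simp⟩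
    rw [plCurve, h1, h2]

@[simp] theorem plCurve_natCast {E : Type u} [AddCommGroup E] [Module ℝ E] (w : ℕ → E) (i : ℕ) :
    plCurve w i = w i := by
  rw [plCurve_eq_lineMap w i le_rfl (by simp)]
  simp

theorem polyline_eq_plCurve {E : Type u} [AddCommGroup E] [Module ℝ E] (p : List E) (t : ℝ) :
    polyline p t = plCurve (fun i => p.getD i 0) (((p.length - 1 : ℕ) : ℝ) * t) := rfl

theorem Trav.comp_plCurve {n : ℕ} {G : Type u} [Group G] {S : AreaLength n G} {E : Type v}
    [AddCommGroup E] [Module ℝ E] {s : E → EuclideanSpace ℝ (Fin n)} {w : ℕ → E}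
    {g : ℕ → ℕ → G} (k : ℕ)
    (h : ∀ i < k, Trav S (fun t => s (AffineMap.lineMap (w i) (w (i + 1)) t)) 0 1 (g i (i + 1))) :
    Trav S (fun t => s (plCurve w t)) 0 k (AreaLength.seqProd g k) := by
  induction k with
  | zero => simpa [AreaLength.seqProd] using Trav.refl S (fun t => s (plCurve w t)) 0
  | succ k ih =>
    refine (ih fun i hi => h i (hi.trans k.lt_succ_self)).trans ?_
    refine (h k k.lt_succ_self).reparam (θ := fun t => t - k) (by simp) (by fun_prop)
      (fun x _ y _ hxy => by simpa using hxy) (by simp) (by simp) fun t ht => ?_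
    rw [plCurve_eq_lineMap w k ht.1 (by simpa using ht.2)]

theorem Trav.comp_polyline {n : ℕ} {G : Type u} [Group G] {S : AreaLength n G} {E : Type v}
    [AddCommGroup E] [Module ℝ E] {s : E → EuclideanSpace ℝ (Fin n)} {p : List E} {g : G}
    (h : Trav S (fun t => s (plCurve (fun i => p.getD i 0) t)) 0 (p.length - 1 : ℕ) g) :
    Trav S (fun t => s (polyline p t)) 0 1 g :=
  h.reparam zero_le_one (θ := fun t => ((p.length - 1 : ℕ) : ℝ) * t) (by fun_prop)
    (fun x _ y _ hxy => mul_le_mul_of_nonneg_left hxy (Nat.cast_nonneg _)) (by simp) (by simp)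
    fun t _ => by rw [polyline_eq_plCurve]

theorem trav_polyline {n : ℕ} {G : Type u} [Group G] (S : AreaLength n G)
    (p : List (EuclideanSpace ℝ (Fin n))) : Trav S (polyline p) 0 1 (S.listProd p) := by
  rw [S.listProd_eq_seqProd]
  refine Trav.comp_polyline (s := id) (Trav.comp_plCurve _ fun i _ => ?_)
  have h := Trav.straight (S := S) zero_le_one
    (straightOn_lineMap (p.getD i 0) (p.getD (i + 1) 0) 0 1)
  rw [AffineMap.lineMap_apply_zero, AffineMap.lineMap_apply_one] at h
  exact h

/-- Both products are products along the common reparametrized curve, where uniqueness applies. -/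
theorem SamePath.trav_eq {n : ℕ} {G : Type u} [Group G] {S : AreaLength n G}
    {p q : ℝ → EuclideanSpace ℝ (Fin n)} (hpq : SamePath p q) {g h : G}
    (hp : Trav S p 0 1 g) (hq : Trav S q 0 1 h) : g = h := by
  obtain ⟨α, β, ⟨hα, hα', hα0, hα1⟩, ⟨hβ, hβ', hβ0, hβ1⟩, heq⟩ := hpq
  exact (hp.reparam (γ' := fun t => p (α t)) zero_le_one hα hα' hα0 hα1 fun _ _ => rfl).unique
    (hq.reparam zero_le_one hβ hβ' hβ0 hβ1 heq)

/-! ### Triangles in the plane -/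

section plane

open MeasureTheory
open scoped Pointwise

/-- The basis vectors of the plane. -/
noncomputable def planeE (i : Fin 2) : EuclideanSpace ℝ (Fin 2) := EuclideanSpace.single i 1

/-- The area of the standard triangle (whose value is irrelevant). -/
noncomputable def stdTriangleArea : ℝ :=
  (volume : Measure (EuclideanSpace ℝ (Fin 2))).real (convexHull ℝ {0, planeE 0, planeE 1})

theorem plane_eq (x : EuclideanSpace ℝ (Fin 2)) : x = x 0 • planeE 0 + x 1 • planeE 1 := by
  ext i
  fin_cases i <;> simp [planeE]

theorem mem_convexHull_triple {E : Type u} [AddCommGroup E] [Module ℝ E] {p q r x : E} :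
    x ∈ convexHull ℝ {p, q, r} ↔
      ∃ a b c : ℝ, 0 ≤ a ∧ 0 ≤ b ∧ 0 ≤ c ∧ a + b + c = 1 ∧ x = a • p + b • q + c • r := by
  constructor
  · intro h
    rw [convexHull_insert (by simp)] at h
    simp only [convexJoin_singleton_left, convexHull_pair, mem_iUnion] at h
    obtain ⟨y, ⟨a, b, ha, hb, hab, rfl⟩, ⟨c, d, hc, hd, hcd, rfl⟩⟩ := h
    refine ⟨c, d * a, d * b, hc, mul_nonneg hd ha, mul_nonneg hd hb, ?_, ?_⟩
    · rw [add_assoc, ← mul_add, hab, mul_one, hcd]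
    · rw [smul_add, smul_smul, smul_smul, add_assoc]
  · rintro ⟨a, b, c, ha, hb, hc, habc, rfl⟩
    have hp : p ∈ convexHull ℝ {p, q, r} := subset_convexHull ℝ _ (by simp)
    have hq : q ∈ convexHull ℝ {p, q, r} := subset_convexHull ℝ _ (by simp)
    have hr : r ∈ convexHull ℝ {p, q, r} := subset_convexHull ℝ _ (by simp)
    have h := (convex_convexHull ℝ {p, q, r}).sum_mem (t := Finset.univ) (w := ![a, b, c])
      (z := ![p, q, r]) (by intro i _; fin_cases i <;> simpa)
      (by simpa [Fin.sum_univ_three] using habc) (by intro i _; fin_cases i <;> simpa)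
    simpa [Fin.sum_univ_three] using h

/-- The triangle contains a nonempty open set. Positivity allows `stdTriangleArea` to be cancelled
from area estimates at the end. -/
theorem stdTriangleArea_pos : 0 < stdTriangleArea := by
  have hU : IsOpen {x : EuclideanSpace ℝ (Fin 2) | 0 < x 0 ∧ 0 < x 1 ∧ x 0 + x 1 < 1} := by
    have h : ∀ i : Fin 2, Continuous fun x : EuclideanSpace ℝ (Fin 2) => x i := by fun_prop
    exact (isOpen_lt continuous_const (h 0)).inter
      ((isOpen_lt continuous_const (h 1)).inter (isOpen_lt ((h 0).add (h 1)) continuous_const))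
  have hsub : {x : EuclideanSpace ℝ (Fin 2) | 0 < x 0 ∧ 0 < x 1 ∧ x 0 + x 1 < 1} ⊆
      convexHull ℝ {0, planeE 0, planeE 1} := by
    rintro x ⟨h0, h1, h2⟩
    rw [mem_convexHull_triple]
    refine ⟨1 - x 0 - x 1, x 0, x 1, by linarith, h0.le, h1.le, by ring, ?_⟩
    rw [smul_zero, zero_add]
    exact plane_eq x
  have hne : {x : EuclideanSpace ℝ (Fin 2) | 0 < x 0 ∧ 0 < x 1 ∧ x 0 + x 1 < 1}.Nonempty :=
    ⟨!₂[1 / 4, 1 / 4], by norm_num⟩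
  refine ENNReal.toReal_pos ((hU.measure_pos volume hne).trans_le (measure_mono hsub)).ne' ?_
  exact ((Set.toFinite _).isCompact_convexHull (𝕜 := ℝ)).measure_lt_top.ne

/-- The triangle is a translate of the image of the standard one under a linear map with determinant
`orient p q r`. -/
theorem volume_triangle (p q r : EuclideanSpace ℝ (Fin 2)) :
    volume.real (convexHull ℝ {p, q, r}) = stdTriangleArea * |orient p q r| := by
  let b := (EuclideanSpace.basisFun (Fin 2) ℝ).toBasis
  let A : Matrix (Fin 2) (Fin 2) ℝ := !![q 0 - p 0, r 0 - p 0; q 1 - p 1, r 1 - p 1]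
  let f := Matrix.toLin b b A
  have hdet : LinearMap.det f = orient p q r := by
    rw [LinearMap.det_toLin, Matrix.det_fin_two_of, orient]
    ring
  have hb : ∀ i, b i = planeE i := fun i => by simp [b, planeE]
  have h0 : f (planeE 0) = q - p := by
    rw [← hb, Matrix.toLin_self, Fin.sum_univ_two, hb, hb, plane_eq (q - p)]
    rfl
  have h1 : f (planeE 1) = r - p := by
    rw [← hb, Matrix.toLin_self, Fin.sum_univ_two, hb, hb, plane_eq (r - p)]
    rfl
  have himg : convexHull ℝ {p, q, r} = p +ᵥ (f '' convexHull ℝ {0, planeE 0, planeE 1}) := by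
    rw [LinearMap.image_convexHull, ← convexHull_vadd]
    congr 1
    simp only [image_insert_eq, image_singleton, h0, h1, map_zero, ← image_vadd, vadd_eq_add]
    simp
  rw [himg, Measure.real, measure_vadd, Measure.addHaar_image_linearMap, ENNReal.toReal_mul,
    hdet, ENNReal.toReal_ofReal (abs_nonneg _), mul_comm]
  rfl

/-- The bivector of the image is multiplied by the determinant `orient p q r`. Thus an affine map
scales all planar areas by one constant factor, which lets image areas be computed by Lebesgue
measure. -/
theorem triArea_affineMap {n : ℕ} (A : EuclideanSpace ℝ (Fin 2) →ᵃ[ℝ] EuclideanSpace ℝ (Fin n))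
    (p q r : EuclideanSpace ℝ (Fin 2)) :
    triArea (A p) (A q) (A r) =
      triArea (A 0) (A (planeE 0)) (A (planeE 1)) * |orient p q r| := by
  have hA : ∀ x, A x = x 0 • A.linear (planeE 0) + x 1 • A.linear (planeE 1) + A 0 := by
    intro x
    have h := A.map_vadd 0 x
    rw [vadd_eq_add, vadd_eq_add, add_zero] at h
    rw [h, ← map_smul, ← map_smul, ← map_add, ← plane_eq]
  have hB : triBivector (A p) (A q) (A r) =
      orient p q r • triBivector (A 0) (A (planeE 0)) (A (planeE 1)) := by
    ext s
    simp only [triBivector, orient, hA p, hA q, hA r, hA (planeE 0), hA (planeE 1),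
      PiLp.add_apply, PiLp.smul_apply, smul_eq_mul]
    simp [planeE]
    ring
  rw [triArea_eq_norm, triArea_eq_norm, hB, norm_smul, Real.norm_eq_abs]
  ring

theorem convex_orient_nonneg (a b : EuclideanSpace ℝ (Fin 2)) :
    Convex ℝ {x | 0 ≤ orient a b x} := by
  intro x hx y hy s t hs ht hst
  simp only [mem_ofPred_eq] at hx hy ⊢
  have h : orient a b (s • x + t • y) = s * orient a b x + t * orient a b y := by
    simp only [orient, PiLp.add_apply, PiLp.smul_apply, smul_eq_mul]
    obtain rfl : s = 1 - t := by linarith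
    ring
  rw [h]
  positivity

theorem volume_orient_eq_zero {a b : EuclideanSpace ℝ (Fin 2)} (hab : a ≠ b) :
    volume {x | orient a b x = 0} = 0 := by
  let L : AffineSubspace ℝ (EuclideanSpace ℝ (Fin 2)) :=
    { carrier := {x | orient a b x = 0}
      smul_vsub_vadd_mem' := by
        intro c x y z hx hy hz
        simp only [mem_ofPred_eq, orient, vsub_eq_sub, vadd_eq_add, PiLp.add_apply,
          PiLp.smul_apply, PiLp.sub_apply, smul_eq_mul] at *
        linear_combination c * hx - c * hy + hz }
  refine Measure.addHaar_affineSubspace volume L fun hL => hab ?_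
  -- The test point is `a` plus a quarter turn of `b - a`; its orientation value is the squared
  -- length of `b - a`.
  have hx : (!₂[a 0 - (b 1 - a 1), a 1 + (b 0 - a 0)] : EuclideanSpace ℝ (Fin 2)) ∈ L := by
    rw [hL]; trivial
  change orient a b _ = 0 at hx
  simp [orient] at hx
  have h0 : b 0 - a 0 = 0 := by nlinarith [sq_nonneg (b 0 - a 0), sq_nonneg (b 1 - a 1)]
  have h1 : b 1 - a 1 = 0 := by nlinarith [sq_nonneg (b 0 - a 0), sq_nonneg (b 1 - a 1)]
  ext i
  fin_cases i
  · simpa using (sub_eq_zero.1 h0).symm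
  · simpa using (sub_eq_zero.1 h1).symm

/-- Triangles on the two sides of a line overlap in a null set. -/
theorem aedisjoint_of_orient {a b p q r p' q' r' : EuclideanSpace ℝ (Fin 2)} (hab : a ≠ b)
    (h : ∀ x ∈ ({p, q, r} : Set (EuclideanSpace ℝ (Fin 2))), 0 ≤ orient a b x)
    (h' : ∀ x ∈ ({p', q', r'} : Set (EuclideanSpace ℝ (Fin 2))), 0 ≤ orient b a x) :
    AEDisjoint volume (convexHull ℝ {p, q, r}) (convexHull ℝ {p', q', r'}) := by
  refine measure_mono_null ?_ (volume_orient_eq_zero hab)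
  rintro x ⟨hx, hx'⟩
  have h1 : 0 ≤ orient a b x := convexHull_min h (convex_orient_nonneg a b) hx
  have h2 : 0 ≤ orient b a x := convexHull_min h' (convex_orient_nonneg b a) hx'
  have h3 : orient b a x = - orient a b x := by simp only [orient]; ring
  exact le_antisymm (by linarith) h1

theorem volume_triangle_ne_top (p q r : EuclideanSpace ℝ (Fin 2)) :
    volume (convexHull ℝ {p, q, r}) ≠ ⊤ :=
  ((Set.toFinite _).isCompact_convexHull (𝕜 := ℝ)).measure_lt_top.ne

theorem volume_triangle_eq_zero {p q r : EuclideanSpace ℝ (Fin 2)} (h : orient p q r = 0) :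
    volume (convexHull ℝ {p, q, r}) = 0 := by
  have h1 := volume_triangle p q r
  rw [h, abs_zero, mul_zero, Measure.real, ENNReal.toReal_eq_zero_iff] at h1
  exact h1.resolve_right (volume_triangle_ne_top p q r)

/-- The line through `m` and `r` separates the two triangles. If `m = r` there is no such line, but
then the first triangle is degenerate and null. -/
theorem aedisjoint_split {p q m : EuclideanSpace ℝ (Fin 2)} (r : EuclideanSpace ℝ (Fin 2))
    (hm : m ∈ segment ℝ p q) :
    AEDisjoint volume (convexHull ℝ {p, m, r}) (convexHull ℝ {m, q, r}) := by
  obtain ⟨s, t, hs, ht, hst, rfl⟩ := hm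
  set m := s • p + t • q with hm
  have h1 : orient m r p = t * orient p q r := by
    simp only [orient, hm, PiLp.add_apply, PiLp.smul_apply, smul_eq_mul]
    obtain rfl : s = 1 - t := by linarith
    ring
  have h2 : orient r m q = s * orient p q r := by
    simp only [orient, hm, PiLp.add_apply, PiLp.smul_apply, smul_eq_mul]
    obtain rfl : s = 1 - t := by linarith
    ring
  have ho : ∀ a b, orient a b a = 0 ∧ orient a b b = 0 ∧ orient a a b = 0 := fun a b =>
    ⟨by simp only [orient]; ring, by simp only [orient]; ring, by simp only [orient]; ring⟩
  have hsw : ∀ a b x, orient a b x = - orient b a x := fun a b x => by simp only [orient]; ring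
  by_cases hmr : m = r
  · refine measure_mono_null inter_subset_left (volume_triangle_eq_zero ?_)
    rw [← hmr]
    exact (ho p m).2.1
  rcases le_total 0 (orient p q r) with h | h
  · refine aedisjoint_of_orient (a := m) (b := r) hmr ?_ ?_
    · rintro x (rfl | rfl | rfl)
      · rw [h1]; positivity
      · exact (ho _ _).1.ge
      · exact (ho _ _).2.1.ge
    · rintro x (rfl | rfl | rfl)
      · exact (ho _ _).2.1.ge
      · rw [h2]; positivity
      · exact (ho _ _).1.ge
  · refine aedisjoint_of_orient (a := r) (b := m) (Ne.symm hmr) ?_ ?_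
    · rintro x (rfl | rfl | rfl)
      · rw [hsw, h1]; nlinarith
      · exact (ho _ _).2.1.ge
      · exact (ho _ _).1.ge
    · rintro x (rfl | rfl | rfl)
      · exact (ho _ _).1.ge
      · rw [hsw, h2]; nlinarith
      · exact (ho _ _).2.1.ge

/-- Almost disjoint triangles contained in a set have at most its volume. -/
theorem sum_volume_inter_le {ι : Type*} (s : Finset ι) {A : ι → Set (EuclideanSpace ℝ (Fin 2))}
    {K T : Set (EuclideanSpace ℝ (Fin 2))} (hA : ∀ i ∈ s, A i ⊆ K)
    (hm : ∀ i ∈ s, MeasurableSet (A i)) (hT : MeasurableSet T) (hfin : volume T ≠ ⊤)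
    (hd : (s : Set ι).Pairwise fun i j => AEDisjoint volume (A i) (A j)) :
    ∑ i ∈ s, volume.real (A i ∩ T) ≤ volume.real (K ∩ T) := by
  rw [← measureReal_biUnion_finset₀ (f := fun i => A i ∩ T)]
  · exact measureReal_mono (iUnion₂_subset fun i hi => inter_subset_inter_left _ (hA i hi))
      (ne_top_of_le_ne_top hfin (measure_mono inter_subset_right))
  · exact fun i hi j hj hij => (hd hi hj hij).mono inter_subset_left inter_subset_left
  · exact fun i hi => ((hm i hi).inter hT).nullMeasurableSet

end plane

/-! ### Cutting segments and triangles along lines -/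

section cutting

variable {V : Type u} [AddCommGroup V] [Module ℝ V]

theorem exists_zero_mem_segment (l : V →ᵃ[ℝ] ℝ) {p q : V} (h : l p * l q < 0) :
    ∃ m ∈ segment ℝ p q, l m = 0 := by
  have hne : l p - l q ≠ 0 := by
    intro h0
    have : l p = l q := by linarith
    rw [this] at h
    nlinarith [sq_nonneg (l q)]
  have ht : 0 ≤ l p / (l p - l q) ∧ l p / (l p - l q) ≤ 1 := by
    rcases lt_or_gt_of_ne hne with h0 | h0
    · exact ⟨div_nonneg_of_nonpos (by nlinarith) h0.le, (div_le_one_of_neg h0).2 (by nlinarith)⟩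
    · exact ⟨div_nonneg (by nlinarith) h0.le, (div_le_one h0).2 (by nlinarith)⟩
  refine ⟨AffineMap.lineMap p q (l p / (l p - l q)), ?_, ?_⟩
  · rw [segment_eq_image_lineMap]
    exact ⟨_, ht, rfl⟩
  · rw [AffineMap.apply_lineMap, AffineMap.lineMap_apply_module']
    simp only [smul_eq_mul]
    field_simp
    ring

/-- Cutting by one line creates no new sign conflicts for the others, so lines can be treated
successively. -/
theorem sameSign_of_mem_segment (l : V →ᵃ[ℝ] ℝ) {p q r m : V} (hm : m ∈ segment ℝ p q)
    (hp : 0 ≤ l p * l r) (hq : 0 ≤ l q * l r) : 0 ≤ l m * l r := by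
  rw [segment_eq_image_lineMap] at hm
  obtain ⟨t, ⟨h0, h1⟩, rfl⟩ := hm
  rw [AffineMap.apply_lineMap, AffineMap.lineMap_apply_module]
  simp only [smul_eq_mul]
  have h2 := mul_nonneg (sub_nonneg.2 h1) hp
  have h3 := mul_nonneg h0 hq
  linarith

/-- A property of segments which holds for unions of two adjacent segments and for all segments
not cut by finitely many lines holds for all segments. -/
theorem segment_induction (L : List (V →ᵃ[ℝ] ℝ)) (Q : V → V → Prop)
    (split : ∀ p q m, m ∈ segment ℝ p q → (Q p m) → Q m q → Q p q)
    (base : ∀ p q, (∀ l ∈ L, 0 ≤ l p * l q) → Q p q) (p q : V) : Q p q := by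
  induction L generalizing p q with
  | nil => exact base p q (by simp)
  | cons l L ih =>
    refine ih (fun p q hL => ?_) p q
    rcases le_or_gt 0 (l p * l q) with h | h
    · exact base p q (by simpa using ⟨h, hL⟩)
    obtain ⟨m, hm, hlm⟩ := exists_zero_mem_segment l h
    refine split p q m hm (base _ _ ?_) (base _ _ ?_) <;>
      refine List.forall_mem_cons.2 ⟨by simp [hlm], fun l' hl' => ?_⟩
    · rw [mul_comm]
      exact sameSign_of_mem_segment l' hm (mul_self_nonneg _) (by rw [mul_comm]; exact hL l' hl')
    · exact sameSign_of_mem_segment l' hm (hL l' hl') (mul_self_nonneg _)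

/-- The three points lie weakly on the same side of the zero line of `l`. -/
def SameSide (l : V →ᵃ[ℝ] ℝ) (p q r : V) : Prop :=
  0 ≤ l p * l q ∧ 0 ≤ l q * l r ∧ 0 ≤ l r * l p

theorem SameSide.split_left {l : V →ᵃ[ℝ] ℝ} {p q r m : V} (h : SameSide l p q r)
    (hm : m ∈ segment ℝ p q) : SameSide l p m r := by
  obtain ⟨h1, h2, h3⟩ := h
  refine ⟨?_, sameSign_of_mem_segment l hm (by linarith) h2, h3⟩
  rw [mul_comm]
  exact sameSign_of_mem_segment l hm (mul_self_nonneg _) (by linarith)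

theorem SameSide.rotate {l : V →ᵃ[ℝ] ℝ} {p q r : V} (h : SameSide l p q r) : SameSide l q r p :=
  ⟨h.2.1, h.2.2, h.1⟩

theorem SameSide.swap {l : V →ᵃ[ℝ] ℝ} {p q r : V} (h : SameSide l p q r) : SameSide l q p r := by
  obtain ⟨h1, h2, h3⟩ := h
  exact ⟨by linarith, by linarith, by linarith⟩

/-- A side crossed by the line is cut at its zero, producing two triangles with a vertex on the
line. Such a triangle needs at most one further cut, from that vertex to the zero on the opposite
side. -/
theorem triangle_induction_single (l : V →ᵃ[ℝ] ℝ) (Q : V → V → V → Prop)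
    (rot : ∀ p q r, Q p q r → Q q r p) (swap : ∀ p q r, Q p q r → Q q p r)
    (split : ∀ p q r m, m ∈ segment ℝ p q → Q p m r → Q m q r → Q p q r)
    (base : ∀ p q r, SameSide l p q r → Q p q r) (p q r : V) : Q p q r := by
  have zero : ∀ p q r, l q = 0 → Q p q r := by
    intro p q r hq
    rcases le_or_gt 0 (l r * l p) with h | h
    · exact base p q r ⟨by simp [hq], by simp [hq], h⟩
    obtain ⟨m, hm, hlm⟩ := exists_zero_mem_segment l h
    refine rot _ _ _ (split r p q m hm ?_ ?_) <;>
    exact base _ _ _ ⟨by simp [hlm], by simp [hq, hlm], by simp [hq]⟩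
  have bad : ∀ p q r, l p * l q < 0 → Q p q r := by
    intro p q r h
    obtain ⟨m, hm, hlm⟩ := exists_zero_mem_segment l h
    exact split p q r m hm (zero p m r hlm) (swap _ _ _ (zero q m r hlm))
  rcases lt_or_ge (l p * l q) 0 with h1 | h1
  · exact bad p q r h1
  rcases lt_or_ge (l q * l r) 0 with h2 | h2
  · exact rot _ _ _ (rot _ _ _ (bad q r p h2))
  rcases lt_or_ge (l r * l p) 0 with h3 | h3
  · exact rot _ _ _ (bad r p q h3)
  exact base p q r ⟨h1, h2, h3⟩

/-- A property of triangles which holds for unions of two adjacent triangles and for all triangles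
not cut by finitely many lines holds for all triangles. -/
theorem triangle_induction (L : List (V →ᵃ[ℝ] ℝ)) (Q : V → V → V → Prop)
    (rot : ∀ p q r, Q p q r → Q q r p) (swap : ∀ p q r, Q p q r → Q q p r)
    (split : ∀ p q r m, m ∈ segment ℝ p q → Q p m r → Q m q r → Q p q r)
    (base : ∀ p q r, (∀ l ∈ L, SameSide l p q r) → Q p q r) (p q r : V) : Q p q r := by
  induction L generalizing p q r with
  | nil => exact base p q r (by simp)
  | cons l L ih =>
    refine ih (fun p q r => ?_) p q r
    refine triangle_induction_single l (fun p q r => (∀ l' ∈ L, SameSide l' p q r) → Q p q r)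
      (fun p q r h hL => rot _ _ _ (h fun l' hl' => (hL l' hl').rotate.rotate))
      (fun p q r h hL => swap _ _ _ (h fun l' hl' => (hL l' hl').swap))
      (fun p q r m hm h1 h2 hL => split p q r m hm
        (h1 fun l' hl' => (hL l' hl').split_left hm)
        (h2 fun l' hl' => ?_))
      (fun p q r h hL => base p q r (List.forall_mem_cons.2 ⟨h, hL⟩)) p q r
    rw [segment_symm] at hm
    exact ((hL l' hl').swap.split_left hm).swap

end cutting

/-! ### Every disk bounds the length of its boundary -/

namespace PLDisk

variable {n : ℕ} (D : PLDisk n)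

/-- The barycentric frame of a triangle of the division. -/
noncomputable def frame (i : Fin D.N) : AffineBasis (Fin 3) ℝ (EuclideanSpace ℝ (Fin 2)) :=
  ⟨D.tri i, D.tri_nondegenerate i,
    ((D.tri_nondegenerate i).affineSpan_eq_top_iff_card_eq_finrank_add_one).2 (by simp)⟩

/-- The domain of a disk. -/
def domain : Set (EuclideanSpace ℝ (Fin 2)) := convexHull ℝ (range D.vertex)

/-- A triangle of the division. -/
def piece (i : Fin D.N) : Set (EuclideanSpace ℝ (Fin 2)) := convexHull ℝ (range (D.tri i))

theorem mem_piece {i : Fin D.N} {x : EuclideanSpace ℝ (Fin 2)} :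
    x ∈ D.piece i ↔ ∀ k, 0 ≤ (D.frame i).coord k x := by
  have h := (D.frame i).convexHull_eq_nonneg_coord
  change D.piece i = _ at h
  rw [h]
  rfl

theorem convex_domain : Convex ℝ D.domain := convex_convexHull ℝ _

theorem exists_mem_piece {x : EuclideanSpace ℝ (Fin 2)} (hx : x ∈ D.domain) :
    ∃ i, x ∈ D.piece i := by
  rw [domain, ← D.tri_cover] at hx
  exact mem_iUnion.1 hx

/-- The barycentric coordinates of all triangles of the division. -/
noncomputable def coords : List (EuclideanSpace ℝ (Fin 2) →ᵃ[ℝ] ℝ) :=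
  (Finset.univ : Finset (Fin D.N × Fin 3)).toList.map fun s => (D.frame s.1).coord s.2

theorem coord_mem_coords (i : Fin D.N) (k : Fin 3) : (D.frame i).coord k ∈ D.coords :=
  List.mem_map.2 ⟨(i, k), by simp, rfl⟩

/-- The centroid lies in some piece. Each barycentric coordinate of that piece has one weak sign on
the three points and a nonnegative average, so it is nonnegative at all of them. -/
theorem exists_piece_of_sameSide {p q r : EuclideanSpace ℝ (Fin 2)} (hp : p ∈ D.domain)
    (hq : q ∈ D.domain) (hr : r ∈ D.domain) (h : ∀ l ∈ D.coords, SameSide l p q r) :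
    ∃ i, p ∈ D.piece i ∧ q ∈ D.piece i ∧ r ∈ D.piece i := by
  have hx : (1 / 3 : ℝ) • p + (1 / 3 : ℝ) • q + (1 / 3 : ℝ) • r ∈ D.domain := by
    have h1 := D.convex_domain.sum_mem (t := Finset.univ) (w := fun _ : Fin 3 => (1 / 3 : ℝ))
      (z := ![p, q, r]) (by intros; norm_num) (by norm_num)
      (by intro i _; fin_cases i <;> simpa)
    simpa [Fin.sum_univ_three] using h1
  obtain ⟨i, hi⟩ := D.exists_mem_piece hx
  have key : ∀ k, 0 ≤ (D.frame i).coord k p ∧ 0 ≤ (D.frame i).coord k q ∧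
      0 ≤ (D.frame i).coord k r := by
    intro k
    obtain ⟨h1, h2, h3⟩ := h _ (D.coord_mem_coords i k)
    have h4 := D.mem_piece.1 hi k
    have h5 : (D.frame i).coord k ((1 / 3 : ℝ) • p + (1 / 3 : ℝ) • q + (1 / 3 : ℝ) • r) =
        ((D.frame i).coord k p + (D.frame i).coord k q + (D.frame i).coord k r) / 3 := by
      have h6 := fun x => congrFun (AffineMap.decomp ((D.frame i).coord k)) x
      simp only [Pi.add_apply] at h6
      rw [h6, h6 p, h6 q, h6 r]
      simp only [map_add, map_smul, smul_eq_mul]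
      ring
    rw [h5] at h4
    -- A negative value at one point forces nonpositive values at the other two, making the average
    -- negative.
    refine ⟨?_, ?_, ?_⟩ <;> by_contra! hneg <;> nlinarith
  exact ⟨i, D.mem_piece.2 fun k => (key k).1, D.mem_piece.2 fun k => (key k).2.1,
    D.mem_piece.2 fun k => (key k).2.2⟩

/-! ### Products of steps along images of planar segments. -/

section edges

variable {G : Type u} [Group G] (S : AreaLength n G)

theorem straightOn_of_mem_piece {i : Fin D.N} {p q : EuclideanSpace ℝ (Fin 2)}
    (hp : p ∈ D.piece i) (hq : q ∈ D.piece i) :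
    StraightOn (fun t : ℝ => D.map (AffineMap.lineMap p q t)) 0 1 := by
  obtain ⟨A, hA⟩ := D.map_affine i
  obtain ⟨x, v, h⟩ := straightOn_lineMap (A p) (A q) 0 1
  refine ⟨x, v, fun t ht => ?_⟩
  have hm : AffineMap.lineMap p q t ∈ D.piece i := by
    refine (convex_convexHull ℝ _).segment_subset hp hq ?_
    rw [segment_eq_image_lineMap]
    exact ⟨t, ht, rfl⟩
  obtain ⟨c, hc⟩ := h t ht
  exact ⟨c, by rw [← hc, ← AffineMap.apply_lineMap]; exact hA hm⟩

theorem trav_edge_trans {s : EuclideanSpace ℝ (Fin 2) → EuclideanSpace ℝ (Fin n)}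
    {p q m : EuclideanSpace ℝ (Fin 2)} (hm : m ∈ segment ℝ p q) {g h : G}
    (h1 : Trav S (fun t => s (AffineMap.lineMap p m t)) 0 1 g)
    (h2 : Trav S (fun t => s (AffineMap.lineMap m q t)) 0 1 h) :
    Trav S (fun t => s (AffineMap.lineMap p q t)) 0 1 (g * h) := by
  -- Constant curves have trivial product. This disposes of cuts at an endpoint, where rescaling by
  -- `c` or `1 - c` would divide by zero.
  have hconst : ∀ (x : EuclideanSpace ℝ (Fin 2)) (g : G),
      Trav S (fun t => s (AffineMap.lineMap x x t)) 0 1 g → g = 1 := by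
    intro x g hg
    rw [hg.eq_of_straightOn ⟨s x, 0, fun t _ => ⟨0, by simp⟩⟩]
    simp [S.e_self]
  rw [segment_eq_image_lineMap] at hm
  obtain ⟨c, ⟨h0, h1'⟩, rfl⟩ := hm
  rcases h0.eq_or_lt with rfl | h0
  · rw [AffineMap.lineMap_apply_zero] at h1 h2
    rw [hconst _ _ h1, one_mul]
    exact h2
  rcases h1'.eq_or_lt with rfl | h1'
  · rw [AffineMap.lineMap_apply_one] at h1 h2
    rw [hconst _ _ h2, mul_one]
    exact h1
  have hne : 1 - c ≠ 0 := by linarith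
  refine Trav.trans (b := c)
    (h1.reparam h0.le (θ := fun t => t / c) (by fun_prop)
      (fun x _ y _ hxy => div_le_div_of_nonneg_right hxy h0.le) (by simp) (by field_simp) ?_)
    (h2.reparam h1'.le (θ := fun t => (t - c) / (1 - c)) (by fun_prop)
      (fun x _ y _ hxy => div_le_div_of_nonneg_right (by linarith) (by linarith)) (by simp)
      (by field_simp) ?_)
  · intro t _
    simp only [AffineMap.lineMap_apply_module]
    congr 1
    match_scalars <;> field_simp
    ring
  · intro t _
    simp only [AffineMap.lineMap_apply_module]
    congr 1
    match_scalars <;> field_simp <;> ring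

/-- Cutting by the sides of all triangles of the division leaves segments that lie in a single
piece, where the map is affine. -/
theorem exists_trav_edge {p q : EuclideanSpace ℝ (Fin 2)} (hp : p ∈ D.domain)
    (hq : q ∈ D.domain) :
    ∃ g, Trav S (fun t => D.map (AffineMap.lineMap p q t)) 0 1 g := by
  revert hp hq
  refine segment_induction D.coords (fun p q => p ∈ D.domain → q ∈ D.domain →
    ∃ g, Trav S (fun t => D.map (AffineMap.lineMap p q t)) 0 1 g) ?_ ?_ p q
  · intro p q m hm h1 h2 hp hq
    have hmD := D.convex_domain.segment_subset hp hq hm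
    obtain ⟨g, hg⟩ := h1 hp hmD
    obtain ⟨h, hh⟩ := h2 hmD hq
    exact ⟨g * h, trav_edge_trans S hm hg hh⟩
  · intro p q h hp hq
    obtain ⟨i, hi, hi', _⟩ := D.exists_piece_of_sameSide hp hq hq fun l hl =>
      ⟨h l hl, mul_self_nonneg _, by rw [mul_comm]; exact h l hl⟩
    exact ⟨_, .straight zero_le_one (D.straightOn_of_mem_piece hi hi')⟩

open Classical in
/-- The product of the steps along the image of the segment from `p` to `q`. -/
noncomputable def edge (p q : EuclideanSpace ℝ (Fin 2)) : G :=
  if h : ∃ g, Trav S (fun t => D.map (AffineMap.lineMap p q t)) 0 1 g then h.choose else 1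

variable {p q r : EuclideanSpace ℝ (Fin 2)}

theorem trav_edge (hp : p ∈ D.domain) (hq : q ∈ D.domain) :
    Trav S (fun t => D.map (AffineMap.lineMap p q t)) 0 1 (D.edge S p q) := by
  rw [edge, dif_pos (D.exists_trav_edge S hp hq)]
  exact (D.exists_trav_edge S hp hq).choose_spec

theorem piece_subset_domain (i : Fin D.N) : D.piece i ⊆ D.domain := by
  rw [domain, ← D.tri_cover]
  exact subset_iUnion (fun i => D.piece i) i

theorem edge_of_mem_piece {i : Fin D.N} (hp : p ∈ D.piece i) (hq : q ∈ D.piece i) :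
    D.edge S p q = S.e (D.map p) (D.map q) := by
  have h := (D.trav_edge S (D.piece_subset_domain i hp)
    (D.piece_subset_domain i hq)).eq_of_straightOn (D.straightOn_of_mem_piece hp hq)
  simpa using h

theorem edge_mul {m : EuclideanSpace ℝ (Fin 2)} (hm : m ∈ segment ℝ p q) (hp : p ∈ D.domain)
    (hq : q ∈ D.domain) : D.edge S p q = D.edge S p m * D.edge S m q := by
  have hmD := D.convex_domain.segment_subset hp hq hm
  exact (D.trav_edge S hp hq).unique
    (trav_edge_trans S hm (D.trav_edge S hp hmD) (D.trav_edge S hmD hq))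

theorem edge_symm (hp : p ∈ D.domain) (hq : q ∈ D.domain) :
    D.edge S q p = (D.edge S p q)⁻¹ := by
  refine (D.trav_edge S hq hp).unique ?_
  have h := (D.trav_edge S hp hq).reverse
    (γ' := fun t => D.map (AffineMap.lineMap p q (-t))) (by simp)
  refine h.reparam zero_le_one (θ := fun t => t - 1) (by fun_prop)
    (fun x _ y _ hxy => by simpa using hxy) (by simp) (by simp) fun t _ => ?_
  congr 1
  simp only [AffineMap.lineMap_apply_module]
  match_scalars <;> ring

/-- The product of the steps around the image of a triangle. -/
noncomputable def loop (p q r : EuclideanSpace ℝ (Fin 2)) : G :=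
  D.edge S p q * D.edge S q r * D.edge S r p

/-- Changing the starting corner conjugates the loop. -/
theorem len_loop_rotate : S.len (D.loop S q r p) = S.len (D.loop S p q r) := by
  rw [← S.len_conj (D.edge S p q) (D.loop S q r p)]
  congr 1
  simp only [loop]
  group

/-- Reversing the orientation inverts the loop, up to the choice of starting corner. -/
theorem len_loop_swap (hp : p ∈ D.domain) (hq : q ∈ D.domain) (hr : r ∈ D.domain) :
    S.len (D.loop S q p r) = S.len (D.loop S p q r) := by
  rw [← D.len_loop_rotate S (p := q), ← S.len_inv]
  congr 1
  rw [loop, loop, D.edge_symm S hq hr, D.edge_symm S hp hq, D.edge_symm S hr hp]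
  have h : ∀ a b c : G, (a⁻¹ * b⁻¹ * c⁻¹)⁻¹ = c * b * a := fun a b c => by group
  rw [h]

/-- The big loop is the loop around `p m r` times a conjugate of the loop around `m q r`; the two
passages along the cut cancel. -/
theorem len_loop_split {m : EuclideanSpace ℝ (Fin 2)} (hm : m ∈ segment ℝ p q)
    (hp : p ∈ D.domain) (hq : q ∈ D.domain) (hr : r ∈ D.domain) :
    S.len (D.loop S p q r) ≤ S.len (D.loop S p m r) + S.len (D.loop S m q r) := by
  have hmD := D.convex_domain.segment_subset hp hq hm
  rw [← S.len_conj (D.edge S m r * D.edge S r p)⁻¹ (D.loop S m q r)]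
  refine le_trans (le_of_eq ?_) (S.len_mul_le _ _)
  congr 1
  simp only [loop, D.edge_mul S hm hp hq, D.edge_symm S hmD hr]
  group

end edges

/-! ### Image areas as weighted Lebesgue measure, and the bound on the boundary. -/

section area

open MeasureTheory

/-- The affine map which agrees with the disk on a triangle of the division. -/
noncomputable def affineOn (i : Fin D.N) :
    EuclideanSpace ℝ (Fin 2) →ᵃ[ℝ] EuclideanSpace ℝ (Fin n) :=
  (D.map_affine i).choose

theorem map_eq_affineOn {i : Fin D.N} {x : EuclideanSpace ℝ (Fin 2)} (hx : x ∈ D.piece i) :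
    D.map x = D.affineOn i x :=
  (D.map_affine i).choose_spec hx

/-- The factor by which the disk scales areas on a triangle of the division. -/
noncomputable def scale (i : Fin D.N) : ℝ :=
  triArea (D.affineOn i 0) (D.affineOn i (planeE 0)) (D.affineOn i (planeE 1))

theorem scale_nonneg (i : Fin D.N) : 0 ≤ D.scale i := triArea_nonneg _ _ _

/-- The area of the image of a region of the plane, in units of `stdTriangleArea`. -/
noncomputable def imageArea (K : Set (EuclideanSpace ℝ (Fin 2))) : ℝ :=
  ∑ i, D.scale i * volume.real (K ∩ D.piece i)

theorem triArea_map_eq {i : Fin D.N} {p q r : EuclideanSpace ℝ (Fin 2)} (hp : p ∈ D.piece i)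
    (hq : q ∈ D.piece i) (hr : r ∈ D.piece i) :
    stdTriangleArea * triArea (D.map p) (D.map q) (D.map r) =
      D.scale i * volume.real (convexHull ℝ {p, q, r}) := by
  rw [D.map_eq_affineOn hp, D.map_eq_affineOn hq, D.map_eq_affineOn hr, triArea_affineMap,
    volume_triangle, scale]
  ring

theorem isCompact_piece (i : Fin D.N) : IsCompact (D.piece i) :=
  (finite_range _).isCompact_convexHull (𝕜 := ℝ)

theorem measurableSet_triangle (p q r : EuclideanSpace ℝ (Fin 2)) :
    MeasurableSet (convexHull ℝ {p, q, r}) :=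
  ((toFinite _).isCompact_convexHull (𝕜 := ℝ)).measurableSet

/-- Superadditivity holds piece by piece for Lebesgue measure, and the weights are nonnegative. -/
theorem sum_imageArea_le {ι : Type*} (s : Finset ι) {A : ι → Set (EuclideanSpace ℝ (Fin 2))}
    {K : Set (EuclideanSpace ℝ (Fin 2))} (hA : ∀ i ∈ s, A i ⊆ K)
    (hm : ∀ i ∈ s, MeasurableSet (A i))
    (hd : (s : Set ι).Pairwise fun i j => AEDisjoint volume (A i) (A j)) :
    ∑ i ∈ s, D.imageArea (A i) ≤ D.imageArea K := by
  simp only [imageArea]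
  rw [Finset.sum_comm]
  refine Finset.sum_le_sum fun i _ => ?_
  rw [← Finset.mul_sum]
  exact mul_le_mul_of_nonneg_left (sum_volume_inter_le s hA hm (D.isCompact_piece i).measurableSet
    (D.isCompact_piece i).measure_lt_top.ne hd) (D.scale_nonneg i)

theorem imageArea_univ : D.imageArea univ = stdTriangleArea * D.area := by
  rw [imageArea, area, Finset.mul_sum]
  refine Finset.sum_congr rfl fun i _ => ?_
  have hmem : ∀ k, D.tri i k ∈ D.piece i := fun k => subset_convexHull ℝ _ (mem_range_self k)
  rw [D.triArea_map_eq (hmem 0) (hmem 1) (hmem 2), univ_inter, piece]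
  congr 3
  ext x
  simp [Fin.exists_fin_succ, eq_comm]

variable {G : Type u} [Group G] (S : AreaLength n G)

/-- Both sides behave well under cuts: the length is subadditive and the image area superadditive.
This leaves triangles inside one piece, where the area axiom of `AreaLength` and affine scaling give
the bound. -/
theorem len_loop_le (p q r : EuclideanSpace ℝ (Fin 2)) (hp : p ∈ D.domain) (hq : q ∈ D.domain)
    (hr : r ∈ D.domain) :
    stdTriangleArea * S.len (D.loop S p q r) ≤ D.imageArea (convexHull ℝ {p, q, r}) := by
  revert hp hq hr
  refine triangle_induction D.coords (fun p q r => p ∈ D.domain → q ∈ D.domain → r ∈ D.domain →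
    stdTriangleArea * S.len (D.loop S p q r) ≤ D.imageArea (convexHull ℝ {p, q, r}))
    ?_ ?_ ?_ ?_ p q r
  · intro p q r h hq hr hp
    rw [D.len_loop_rotate S, pair_comm r p, insert_comm q p]
    exact h hp hq hr
  · intro p q r h hq hp hr
    rw [D.len_loop_swap S hp hq hr, insert_comm]
    exact h hp hq hr
  · intro p q r m hm h1 h2 hp hq hr
    have hmD := D.convex_domain.segment_subset hp hq hm
    have hsum := D.sum_imageArea_le Finset.univ
      (A := ![convexHull ℝ {p, m, r}, convexHull ℝ {m, q, r}]) (K := convexHull ℝ {p, q, r})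
      ?_ ?_ ?_
    · rw [Fin.sum_univ_two] at hsum
      refine le_trans ?_ ((add_le_add (h1 hp hmD hr) (h2 hmD hq hr)).trans hsum)
      rw [← mul_add]
      exact mul_le_mul_of_nonneg_left (D.len_loop_split S hm hp hq hr) stdTriangleArea_pos.le
    · have hm' : m ∈ convexHull ℝ {p, q, r} :=
        (convex_convexHull ℝ _).segment_subset (subset_convexHull ℝ _ (by simp))
          (subset_convexHull ℝ _ (by simp)) hm
      have hs : ∀ x ∈ ({p, q, r} : Set _), x ∈ convexHull ℝ {p, q, r} :=
        fun x hx => subset_convexHull ℝ _ hx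
      intro i _
      fin_cases i <;> refine convexHull_min ?_ (convex_convexHull ℝ _)
      · rintro x (rfl | rfl | rfl)
        exacts [hs _ (by simp), hm', hs _ (by simp)]
      · rintro x (rfl | rfl | rfl)
        exacts [hm', hs _ (by simp), hs _ (by simp)]
    · intro i _
      fin_cases i <;> exact measurableSet_triangle _ _ _
    · intro i _ j _ hij
      fin_cases i <;> fin_cases j
      · exact absurd rfl hij
      · exact aedisjoint_split r hm
      · exact (aedisjoint_split r hm).symm
      · exact absurd rfl hij
  · intro p q r h hp hq hr
    obtain ⟨i, hpi, hqi, hri⟩ := D.exists_piece_of_sameSide hp hq hr h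
    rw [loop, D.edge_of_mem_piece S hpi hqi, D.edge_of_mem_piece S hqi hri,
      D.edge_of_mem_piece S hri hpi]
    refine (mul_le_mul_of_nonneg_left (S.len_triangle _ _ _) stdTriangleArea_pos.le).trans ?_
    rw [D.triArea_map_eq hpi hqi hri, imageArea]
    have hsub : convexHull ℝ {p, q, r} ⊆ D.piece i := by
      refine convexHull_min ?_ (convex_convexHull ℝ _)
      rintro x (rfl | rfl | rfl)
      exacts [hpi, hqi, hri]
    nth_rewrite 1 [← inter_eq_left.2 hsub]
    exact Finset.single_le_sum (f := fun j => D.scale j *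
      volume.real (convexHull ℝ {p, q, r} ∩ D.piece j))
      (fun j _ => mul_nonneg (D.scale_nonneg j) measureReal_nonneg) (Finset.mem_univ i)

/-- The closed polygon is filled by triangles with common apex `w 0`; each new vertex multiplies the
loop by one more triangle loop. The term `i = 0` is a degenerate triangle. -/
theorem len_fan_le (w : ℕ → EuclideanSpace ℝ (Fin 2)) (k : ℕ) (hw : ∀ i ≤ k, w i ∈ D.domain) :
    stdTriangleArea * S.len (AreaLength.seqProd (fun i j => D.edge S (w i) (w j)) k *
      D.edge S (w k) (w 0)) ≤
      ∑ i ∈ Finset.range k, D.imageArea (convexHull ℝ {w 0, w i, w (i + 1)}) := by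
  induction k with
  | zero =>
    have h0 : D.edge S (w 0) (w 0) = 1 := by
      obtain ⟨i, hi⟩ := D.exists_mem_piece (hw 0 le_rfl)
      rw [D.edge_of_mem_piece S hi hi, S.e_self]
    simp [AreaLength.seqProd, h0, S.len_one]
  | succ k ih =>
    rw [Finset.sum_range_succ]
    have h1 := ih fun i hi => hw i (hi.trans k.le_succ)
    have h2 := D.len_loop_le S (w 0) (w k) (w (k + 1)) (hw 0 (Nat.zero_le _)) (hw k k.le_succ)
      (hw _ le_rfl)
    refine le_trans ?_ (add_le_add h1 h2)
    rw [← mul_add]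
    refine mul_le_mul_of_nonneg_left (le_trans (le_of_eq ?_) (S.len_mul_le _ _))
      stdTriangleArea_pos.le
    congr 1
    rw [loop, AreaLength.seqProd, D.edge_symm S (hw 0 (Nat.zero_le _)) (hw k k.le_succ)]
    group

theorem m_pos : 0 < D.m := by
  by_contra h
  have h0 : IsEmpty (Fin D.m) := by rw [show D.m = 0 by omega]; infer_instance
  have h1 := D.interior_nonempty
  simp [range_eq_empty] at h1

/-- The vertices of the domain, in cyclic order, as a sequence. -/
noncomputable def vertexSeq (i : ℕ) : EuclideanSpace ℝ (Fin 2) :=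
  (List.ofFn D.vertex ++ (List.ofFn D.vertex).take 1).getD i 0

theorem vertexSeq_of_lt {i : ℕ} (h : i < D.m) : D.vertexSeq i = D.vertex ⟨i, h⟩ := by
  rw [vertexSeq, List.getD_append _ _ _ _ (by simpa using h)]
  simp [List.getD, h]

theorem vertexSeq_m : D.vertexSeq D.m = D.vertexSeq 0 := by
  rw [D.vertexSeq_of_lt D.m_pos, vertexSeq, List.getD_append_right _ _ _ _ (by simp)]
  have h := D.m_pos
  simp [List.getD, h]

theorem vertexSeq_mem_domain {i : ℕ} (h : i ≤ D.m) : D.vertexSeq i ∈ D.domain := by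
  rcases h.eq_or_lt with rfl | h
  · rw [vertexSeq_m, D.vertexSeq_of_lt D.m_pos]
    exact subset_convexHull ℝ _ (mem_range_self _)
  · rw [D.vertexSeq_of_lt h]
    exact subset_convexHull ℝ _ (mem_range_self _)

theorem trav_boundary : Trav S D.boundary 0 1
    (AreaLength.seqProd (fun i j => D.edge S (D.vertexSeq i) (D.vertexSeq j)) D.m) := by
  have hlen : (List.ofFn D.vertex ++ (List.ofFn D.vertex).take 1).length - 1 = D.m := by
    have := D.m_pos
    simp
    omega
  refine Trav.comp_polyline ?_
  rw [hlen]
  exact Trav.comp_plCurve (w := D.vertexSeq) _ fun i hi =>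
    D.trav_edge S (D.vertexSeq_mem_domain hi.le) (D.vertexSeq_mem_domain hi)

/-- The diagonal from vertex `0` to vertex `j` separates the two triangles, by the counterclockwise
order. It is a genuine line because the vertices are distinct. -/
theorem fan_aedisjoint {i j : ℕ} (hij : i < j) (hj : j + 1 < D.m) :
    AEDisjoint volume
      (convexHull ℝ {D.vertexSeq 0, D.vertexSeq i, D.vertexSeq (i + 1)})
      (convexHull ℝ {D.vertexSeq 0, D.vertexSeq j, D.vertexSeq (j + 1)}) := by
  have ho : ∀ a b : EuclideanSpace ℝ (Fin 2), orient a b a = 0 ∧ orient a b b = 0 := fun a b =>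
    ⟨by simp only [orient]; ring, by simp only [orient]; ring⟩
  have hcyc : ∀ a b c : EuclideanSpace ℝ (Fin 2), orient a b c = orient b c a := fun a b c => by
    simp only [orient]; ring
  have hccw : ∀ a b c : ℕ, a ≤ b → b ≤ c → c < D.m →
      0 ≤ orient (D.vertexSeq a) (D.vertexSeq b) (D.vertexSeq c) := by
    intro a b c hab hbc hc
    rcases hab.eq_or_lt with rfl | hab
    · rw [hcyc, (ho _ _).1]
    rcases hbc.eq_or_lt with rfl | hbc
    · rw [(ho _ _).2]
    rw [D.vertexSeq_of_lt hc, D.vertexSeq_of_lt (hbc.trans hc),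
      D.vertexSeq_of_lt (hab.trans (hbc.trans hc))]
    exact D.counterclockwise _ _ _ hab hbc
  have hj0 : D.vertexSeq 0 ≠ D.vertexSeq j := by
    rw [D.vertexSeq_of_lt D.m_pos, D.vertexSeq_of_lt (by omega : j < D.m)]
    intro h
    have := congrArg Fin.val (D.vertex_injective h)
    simp only at this
    omega
  refine aedisjoint_of_orient (Ne.symm hj0) ?_ ?_
  · rintro x (rfl | rfl | rfl) <;> rw [hcyc]
    · exact hccw _ _ _ le_rfl (Nat.zero_le _) (by omega)
    · exact hccw _ _ _ (Nat.zero_le _) hij.le (by omega)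
    · exact hccw _ _ _ (Nat.zero_le _) (by omega) (by omega)
  · rintro x (rfl | rfl | rfl)
    · rw [(ho _ _).1]
    · rw [(ho _ _).2]
    · exact hccw _ _ _ (Nat.zero_le _) (Nat.le_succ _) hj

/-- The boundary of a disk has at most the length given by the area of the disk. -/
theorem len_listProd_le {p : List (EuclideanSpace ℝ (Fin n))}
    (h : SamePath D.boundary (polyline p)) : S.len (S.listProd p) ≤ D.area := by
  rw [← h.trav_eq (D.trav_boundary S) (trav_polyline S p)]
  -- The fan uses the vertices up to `k`, the last one; its closing edge back to vertex `0` is the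
  -- final step of the boundary.
  obtain ⟨k, hk⟩ : ∃ k, D.m = k + 1 := ⟨D.m - 1, by have := D.m_pos; omega⟩
  refine le_of_mul_le_mul_left ?_ stdTriangleArea_pos
  rw [← D.imageArea_univ]
  have h1 := D.len_fan_le S D.vertexSeq k fun i hi => D.vertexSeq_mem_domain (by omega)
  rw [← D.vertexSeq_m] at h1
  have h2 : AreaLength.seqProd (fun i j => D.edge S (D.vertexSeq i) (D.vertexSeq j)) k *
      D.edge S (D.vertexSeq k) (D.vertexSeq D.m) =
      AreaLength.seqProd (fun i j => D.edge S (D.vertexSeq i) (D.vertexSeq j)) D.m := by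
    rw [hk, AreaLength.seqProd]
  rw [h2, D.vertexSeq_m] at h1
  refine h1.trans (D.sum_imageArea_le _ (fun _ _ => subset_univ _)
    (fun _ _ => measurableSet_triangle _ _ _) ?_)
  intro i hi j hj hij
  simp only [Finset.coe_range, mem_Iio] at hi hj
  rcases lt_or_gt_of_ne hij with h | h
  · exact D.fan_aedisjoint h (by omega)
  · exact (D.fan_aedisjoint h (by omega)).symm

end area

end PLDisk

/-! ### The group of loops of a functorial distance -/

section groupoid

variable {C : Type u} [Groupoid.{v} C] {φ : ∀ ⦃x y : C⦄, (x ⟶ y) → (x ⟶ y) → ℝ}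

/-- Composition does not increase distances, and composing with the inverse gives the opposite
inequality. -/
theorem IsPseudoMetrized.comp_left_eq (hφ : IsPseudoMetrized C φ) {x y z : C} (h : x ⟶ y)
    (f g : y ⟶ z) : φ (h ≫ f) (h ≫ g) = φ f g := by
  have key : ∀ {x y : C} (h : x ⟶ y) (f g : y ⟶ z), φ (h ≫ f) (h ≫ g) ≤ φ f g := by
    intro x y h f g
    simpa [hφ.self] using hφ.comp_le h h f g
  refine le_antisymm (key h f g) ?_
  simpa using key (inv h) (h ≫ f) (h ≫ g)

theorem IsPseudoMetrized.comp_right_eq (hφ : IsPseudoMetrized C φ) {x y z : C} (f g : x ⟶ y)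
    (h : y ⟶ z) : φ (f ≫ h) (g ≫ h) = φ f g := by
  have key : ∀ {y z : C} (f g : x ⟶ y) (h : y ⟶ z), φ (f ≫ h) (g ≫ h) ≤ φ f g := by
    intro y z f g h
    simpa [hφ.self] using hφ.comp_le f g h h
  refine le_antisymm (key f g h) ?_
  simpa using key (f ≫ h) (g ≫ h) (inv h)

/-- A pseudo-metrized groupoid with an arrow for every pair of points of `ℝⁿ`, such that triangles
of arrows commute up to the area, gives an area length on its vertex groups. -/
noncomputable def IsPseudoMetrized.areaLength {n : ℕ} (hφ : IsPseudoMetrized C φ)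
    {X : EuclideanSpace ℝ (Fin n) → C} (a : ∀ x y, X x ⟶ X y) (ha : ∀ x, a x x = 𝟙 (X x))
    (ha' : ∀ x y z, triArea x y z = 0 → a x y ≫ a y z = a x z)
    (hd : ∀ x y z, φ (a x y ≫ a y z) (a x z) ≤ triArea x y z) (o : EuclideanSpace ℝ (Fin n)) :
    AreaLength n (X o ⟶ X o) :=
  have hinv : ∀ x y, a x y ≫ a y x = 𝟙 (X x) := fun x y => by rw [ha' _ _ _ (by simp), ha]
  { e := fun x y => a o x ≫ a x y ≫ a y o
    len := fun g => φ g (𝟙 (X o))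
    e_self := fun x => by
      rw [ha, Category.id_comp, hinv]
      rfl
    e_mul := fun x y z h => by
      change (a o x ≫ a x y ≫ a y o) ≫ (a o y ≫ a y z ≫ a z o) = a o x ≫ a x z ≫ a z o
      rw [← ha' x y z h]
      simp only [Category.assoc]
      rw [← Category.assoc (a y o), hinv, Category.id_comp]
    len_one := hφ.self _
    len_mul_le := fun g h => by
      change φ (g ≫ h) (𝟙 _) ≤ _
      simpa using hφ.comp_le g (𝟙 _) h (𝟙 _)
    len_conj := fun g h => by
      have h1 : g * h * g⁻¹ = g ≫ h ≫ Groupoid.inv g := mul_assoc g h g⁻¹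
      have h2 : 𝟙 (X o) = g ≫ 𝟙 (X o) ≫ Groupoid.inv g := by simp
      rw [h1]
      conv_lhs => rw [h2]
      rw [hφ.comp_left_eq, hφ.comp_right_eq]
    len_inv := fun g => by
      have h1 : g ≫ g⁻¹ = 𝟙 (X o) := mul_inv_cancel g
      rw [← hφ.comp_left_eq g, h1, Category.comp_id, hφ.symm]
    len_triangle := fun x y z => by
      have h1 : (a o x ≫ a x y ≫ a y o) * (a o y ≫ a y z ≫ a z o) * (a o z ≫ a z x ≫ a x o) =
          (a o x ≫ (a x y ≫ a y z) ≫ a z x ≫ a x o : X o ⟶ X o) := by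
        change ((a o x ≫ a x y ≫ a y o) ≫ (a o y ≫ a y z ≫ a z o)) ≫ (a o z ≫ a z x ≫ a x o) = _
        simp only [Category.assoc]
        rw [← Category.assoc (a y o), hinv, Category.id_comp, ← Category.assoc (a z o), hinv,
          Category.id_comp]
      have h2 : 𝟙 (X o) = a o x ≫ a x z ≫ a z x ≫ a x o := by
        rw [← Category.assoc (a x z), hinv, Category.id_comp, hinv]
      rw [h1, h2, hφ.comp_left_eq, hφ.comp_right_eq]
      exact hd x y z }

end groupoid

/-- Arrows at distance zero. -/
def zeroRel {C : Type u} [Category.{v} C] (φ : ∀ ⦃x y : C⦄, (x ⟶ y) → (x ⟶ y) → ℝ) : HomRel C :=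
  fun _ _ f g => φ f g = 0

theorem IsPseudoMetrized.congruence {C : Type u} [Category.{v} C]
    {φ : ∀ ⦃x y : C⦄, (x ⟶ y) → (x ⟶ y) → ℝ} (hφ : IsPseudoMetrized C φ) :
    Congruence (zeroRel φ) where
  comp_left f g g' h := le_antisymm
    ((hφ.comp_le f f g g').trans_eq (by rw [hφ.self, zero_add]; exact h)) (hφ.nonneg _ _)
  comp_right g h := le_antisymm
    ((hφ.comp_le _ _ g g).trans_eq (by rw [hφ.self, add_zero]; exact h)) (hφ.nonneg _ _)
  equivalence :=
    { refl := fun f => hφ.self f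
      symm := fun {f g} h => (hφ.symm g f).trans h
      trans := fun {f g k} h h' => le_antisymm
        ((hφ.triangle f k g).trans_eq (by rw [show φ f g = 0 from h, show φ g k = 0 from h', add_zero]))
        (hφ.nonneg _ _) }

theorem IsPseudoMetrized.congr {C : Type u} [Category.{v} C]
    {φ : ∀ ⦃x y : C⦄, (x ⟶ y) → (x ⟶ y) → ℝ} (hφ : IsPseudoMetrized C φ) {x y : C}
    {f f' g g' : x ⟶ y} (h : φ f f' = 0) (h' : φ g g' = 0) : φ f g = φ f' g' := by
  have h1 := hφ.triangle f g f'
  have h2 := hφ.triangle f' g g'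
  have h3 := hφ.triangle f' g' f
  have h4 := hφ.triangle f g' g
  rw [hφ.symm g' g] at h2
  rw [hφ.symm f' f] at h3
  linarith

/-- The distance induced on the quotient by the relation of distance zero. -/
noncomputable def quotDist {C : Type u} [Category.{v} C]
    (φ : ∀ ⦃x y : C⦄, (x ⟶ y) → (x ⟶ y) → ℝ) ⦃x y : CategoryTheory.Quotient (zeroRel φ)⦄
    (f g : x ⟶ y) : ℝ :=
  φ (x := x.as) (y := y.as) ((CategoryTheory.Quotient.functor (zeroRel φ)).preimage f)
    ((CategoryTheory.Quotient.functor (zeroRel φ)).preimage g)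

/-- The chosen representative of a class is at distance zero from any other, so the choice does not
affect distances. -/
theorem IsPseudoMetrized.quotDist_map {C : Type u} [Category.{v} C]
    {φ : ∀ ⦃x y : C⦄, (x ⟶ y) → (x ⟶ y) → ℝ} (hφ : IsPseudoMetrized C φ) {x y : C}
    (f g : x ⟶ y) : quotDist φ ((CategoryTheory.Quotient.functor (zeroRel φ)).map f)
      ((CategoryTheory.Quotient.functor (zeroRel φ)).map g) = φ f g := by
  have := hφ.congruence
  have key : ∀ f : x ⟶ y, φ ((CategoryTheory.Quotient.functor (zeroRel φ)).preimage
      ((CategoryTheory.Quotient.functor (zeroRel φ)).map f)) f = 0 := fun f =>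
    (CategoryTheory.Quotient.functor_map_eq_iff (zeroRel φ) _ _).1
      (Functor.map_preimage _ _)
  exact hφ.congr (key f) (key g)

theorem IsPseudoMetrized.isPseudoMetrized_quotDist {C : Type u} [Category.{v} C]
    {φ : ∀ ⦃x y : C⦄, (x ⟶ y) → (x ⟶ y) → ℝ} (hφ : IsPseudoMetrized C φ) :
    IsPseudoMetrized (CategoryTheory.Quotient (zeroRel φ)) (quotDist φ) where
  self f := hφ.self _
  symm f g := hφ.symm _ _
  triangle f g h := hφ.triangle _ _ _
  comp_le {x y z} f f' g g' := by
    have hs : ∀ {x y : CategoryTheory.Quotient (zeroRel φ)} (f : x ⟶ y),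
        ∃ p : x.as ⟶ y.as, (CategoryTheory.Quotient.functor (zeroRel φ)).map p = f := fun f =>
      (CategoryTheory.Quotient.functor (zeroRel φ)).map_surjective f
    obtain ⟨f, rfl⟩ := hs f
    obtain ⟨f', rfl⟩ := hs f'
    obtain ⟨g, rfl⟩ := hs g
    obtain ⟨g', rfl⟩ := hs g'
    rw [← Functor.map_comp, ← Functor.map_comp, hφ.quotDist_map, hφ.quotDist_map,
      hφ.quotDist_map]
    exact hφ.comp_le f f' g g'

/-- In a pseudo-metrized category in which all arrows are invertible up to distance zero and
triangles of arrows between points commute up to the area, distances are lengths of loops. -/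
theorem IsPseudoMetrized.exists_areaLength {n : ℕ} {C : Type u} [Category.{v} C]
    {φ : ∀ ⦃x y : C⦄, (x ⟶ y) → (x ⟶ y) → ℝ} (hφ : IsPseudoMetrized C φ)
    {X : EuclideanSpace ℝ (Fin n) → C} (a : ∀ x y, X x ⟶ X y)
    (ha : ∀ x, φ (a x x) (𝟙 (X x)) = 0)
    (hd : ∀ x y z, φ (a x y ≫ a y z) (a x z) ≤ triArea x y z)
    (hinv : ∀ {x y : C} (f : x ⟶ y), ∃ g : y ⟶ x, φ (f ≫ g) (𝟙 x) = 0 ∧ φ (g ≫ f) (𝟙 y) = 0) :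
    ∃ (G : Type v) (_ : Group G) (S : AreaLength n G) (cl : ∀ x y, (X x ⟶ X y) → G),
      (∀ x, cl x x (𝟙 _) = 1) ∧ (∀ x y, cl x y (a x y) = S.e x y) ∧
      (∀ x y z f g, cl x z (f ≫ g) = cl x y f * cl y z g) ∧
      ∀ x y f g, φ f g = S.len (cl x y f * (cl x y g)⁻¹) := by
  have := hφ.congruence
  let Q := CategoryTheory.Quotient.functor (zeroRel φ)
  have hmap : ∀ {x y : C} (f g : x ⟶ y), φ f g = 0 → Q.map f = Q.map g := fun f g h =>
    CategoryTheory.Quotient.sound _ h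
  have hiso : ∀ {x y : CategoryTheory.Quotient (zeroRel φ)} (f : x ⟶ y), IsIso f := by
    intro x y f
    obtain ⟨f, rfl⟩ := Q.map_surjective (X := x.as) (Y := y.as) f
    obtain ⟨g, h1, h2⟩ := hinv f
    exact ⟨Q.map g, by rw [← Q.map_comp, hmap _ _ h1, Q.map_id]; rfl,
      by rw [← Q.map_comp, hmap _ _ h2, Q.map_id]; rfl⟩
  let : Groupoid (CategoryTheory.Quotient (zeroRel φ)) := Groupoid.ofIsIso hiso
  have hb : ∀ x, Q.map (a x x) = 𝟙 (Q.obj (X x)) := fun x => by rw [hmap _ _ (ha x), Q.map_id]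
  have hd' : ∀ x y z, quotDist φ (Q.map (a x y) ≫ Q.map (a y z)) (Q.map (a x z)) ≤
      triArea x y z := fun x y z => by
    rw [← Q.map_comp, hφ.quotDist_map]
    exact hd x y z
  have hb' : ∀ x y z, triArea x y z = 0 → Q.map (a x y) ≫ Q.map (a y z) = Q.map (a x z) := by
    intro x y z h0
    rw [← Q.map_comp]
    exact hmap _ _ (le_antisymm ((hd x y z).trans_eq h0) (hφ.nonneg _ _))
  have hbi : ∀ x y, Q.map (a x y) ≫ Q.map (a y x) = 𝟙 (Q.obj (X x)) := fun x y => by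
    rw [hb' _ _ _ (by simp), hb]
  -- The origin is an arbitrary base point; arrows become loops by joining their ends to it with the
  -- chosen straight arrows.
  let S := hφ.isPseudoMetrized_quotDist.areaLength (X := fun x => Q.obj (X x))
    (fun x y => Q.map (a x y)) hb hb' hd' 0
  refine ⟨Q.obj (X 0) ⟶ Q.obj (X 0), inferInstance, S,
    fun x y f => Q.map (a 0 x) ≫ Q.map f ≫ Q.map (a y 0), fun x => ?_, fun x y => rfl,
    fun x y z f g => ?_, fun x y f g => ?_⟩
  · change Q.map (a 0 x) ≫ Q.map (𝟙 (X x)) ≫ Q.map (a x 0) = 𝟙 _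
    rw [Q.map_id, Category.id_comp, hbi]
  · change _ = (Q.map (a 0 x) ≫ Q.map f ≫ Q.map (a y 0)) ≫
      (Q.map (a 0 y) ≫ Q.map g ≫ Q.map (a z 0))
    simp only [Category.assoc, Q.map_comp]
    rw [← Category.assoc (Q.map (a y 0)), hbi, Category.id_comp]
  -- Writing the identity as a loop times its inverse, bi-invariance of the distance cancels that
  -- inverse and then the connecting arrows.
  · change _ = quotDist φ (_ ≫ Groupoid.inv _) (𝟙 _)
    rw [← Groupoid.comp_inv (Q.map (a 0 x) ≫ Q.map g ≫ Q.map (a y 0)),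
      hφ.isPseudoMetrized_quotDist.comp_right_eq, hφ.isPseudoMetrized_quotDist.comp_left_eq,
      hφ.isPseudoMetrized_quotDist.comp_right_eq, hφ.quotDist_map]

/-- Every functorial distance is the length of a loop in a group of paths. -/
theorem IsFunctorialDistance.exists_areaLength {n : ℕ}
    {φ : ∀ ⦃x y : Paths (Coarse (EuclideanSpace ℝ (Fin n)))⦄, (x ⟶ y) → (x ⟶ y) → ℝ}
    (hφ : IsFunctorialDistance (areaAC n) φ) :
    ∃ (G : Type) (_ : Group G) (S : AreaLength n G),
      ∀ (x y : Paths (Coarse (EuclideanSpace ℝ (Fin n)))) (f g : x ⟶ y),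
        φ f g = S.len (S.listProd (pathPoints f) * (S.listProd (pathPoints g))⁻¹) := by
  have hP := hφ.toIsPseudoMetrized
  let X : EuclideanSpace ℝ (Fin n) → Paths (Coarse (EuclideanSpace ℝ (Fin n))) :=
    fun x => Coarse.mk x
  have hone : ∀ x : Paths (Coarse (EuclideanSpace ℝ (Fin n))), φ (straightPath x x) (𝟙 x) = 0 :=
    hφ.unit
  have htri : ∀ x y z : Paths (Coarse (EuclideanSpace ℝ (Fin n))),
      φ (straightPath x y ≫ straightPath y z) (straightPath x z) ≤
        triArea (Coarse.pt x) (Coarse.pt y) (Coarse.pt z) := fun x y z =>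
    hφ.le_d (x := x) (y := y) (z := z) () () ()
  have hback : ∀ x y : Paths (Coarse (EuclideanSpace ℝ (Fin n))),
      φ (straightPath x y ≫ straightPath y x) (𝟙 x) = 0 := fun x y => by
    refine le_antisymm ((hP.triangle _ _ (straightPath x x)).trans ?_) (hP.nonneg _ _)
    rw [hone, add_zero]
    exact (htri x y x).trans_eq (triArea_self_outer _ _)
  have hinv : ∀ {x y : Paths (Coarse (EuclideanSpace ℝ (Fin n)))} (f : x ⟶ y),
      ∃ g : y ⟶ x, φ (f ≫ g) (𝟙 x) = 0 ∧ φ (g ≫ f) (𝟙 y) = 0 := by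
    intro x y f
    refine path_induction (x := x)
      (fun y f => ∃ g : y ⟶ x, φ (f ≫ g) (𝟙 x) = 0 ∧ φ (g ≫ f) (𝟙 y) = 0)
      ⟨𝟙 x, by rw [Category.comp_id]; exact ⟨hP.self _, hP.self _⟩⟩ ?_ f
    rintro y z f ⟨g, h1, h2⟩
    -- Stated for composable pairs so that one argument yields both the left and the right inverse.
    have key : ∀ {x y z : Paths (Coarse (EuclideanSpace ℝ (Fin n)))} (p : x ⟶ y) (q : y ⟶ x)
        (r : y ⟶ z) (s : z ⟶ y), φ (p ≫ q) (𝟙 x) = 0 → φ (r ≫ s) (𝟙 y) = 0 →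
        φ ((p ≫ r) ≫ (s ≫ q)) (𝟙 x) = 0 := by
      intro x y z p q r s hp hr
      refine le_antisymm ?_ (hP.nonneg _ _)
      have h3 := hP.triangle ((p ≫ r) ≫ (s ≫ q)) (𝟙 x) (p ≫ q)
      have h4 := hP.comp_le p p ((r ≫ s) ≫ q) (𝟙 y ≫ q)
      have h5 := hP.comp_le (r ≫ s) (𝟙 y) q q
      rw [Category.id_comp] at h4 h5
      rw [hP.self] at h4 h5
      simp only [Category.assoc] at h3 h4 h5 ⊢
      linarith
    exact ⟨straightPath z y ≫ g, key _ _ _ _ h1 (hback y z), key _ _ _ _ (hback z y) h2⟩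
  obtain ⟨G, hG, S, cl, hcl1, hcla, hclm, hcl⟩ := hP.exists_areaLength (X := X)
    (fun x y => straightPath (X x) (X y)) (fun x => hone (X x))
    (fun x y z => htri (X x) (X y) (X z)) hinv
  have hprod : ∀ (x y : Paths (Coarse (EuclideanSpace ℝ (Fin n)))) (f : x ⟶ y),
      cl (Coarse.pt x) (Coarse.pt y) f = S.listProd (pathPoints f) := by
    intro x y f
    refine path_induction (x := x)
      (fun y f => cl (Coarse.pt x) (Coarse.pt y) f = S.listProd (pathPoints f))
      (hcl1 (Coarse.pt x)) (fun y z f hf => ?_) f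
    have h1 : pathPoints (f ≫ straightPath y z) = (pathPoints f).dropLast ++
        Coarse.pt y :: [Coarse.pt z] := pathPoints_comp _ _
    have h2 : S.listProd [Coarse.pt y, Coarse.pt z] = S.e (Coarse.pt y) (Coarse.pt z) :=
      mul_one _
    rw [h1, S.listProd_append, dropLast_pathPoints, ← hf, h2, ← hcla]
    exact hclm _ _ _ f (straightPath y z)
  refine ⟨G, hG, S, fun x y f g => ?_⟩
  rw [← hprod, ← hprod]
  exact hcl (Coarse.pt x) (Coarse.pt y) f g

theorem AreaLength.listProd_loop {n : ℕ} {G : Type u} [Group G] (S : AreaLength n G)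
    {x y : Paths (Coarse (EuclideanSpace ℝ (Fin n)))} (f g : x ⟶ y) :
    S.listProd (pathPoints f ++ (pathPoints g).reverse.tail) =
      S.listProd (pathPoints f) * (S.listProd (pathPoints g))⁻¹ := by
  have h : (pathPoints g).reverse = Coarse.pt y :: (pathPoints g).reverse.tail := by
    rw [← dropLast_pathPoints g]
    simp
  rw [← S.listProd_reverse, h, List.tail_cons, ← dropLast_pathPoints f, List.append_assoc,
    List.singleton_append, S.listProd_append]

/-- Every functorial distance is bounded by the areas of the fillings. -/
theorem IsFunctorialDistance.le_fillingArea {n : ℕ}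
    {φ : ∀ ⦃x y : Paths (Coarse (EuclideanSpace ℝ (Fin n)))⦄, (x ⟶ y) → (x ⟶ y) → ℝ}
    (hφ : IsFunctorialDistance (areaAC n) φ)
    {x y : Paths (Coarse (EuclideanSpace ℝ (Fin n)))} (f g : x ⟶ y) {r : ℝ}
    (hr : r ∈ fillingAreas (loopPath f g)) : φ f g ≤ r := by
  obtain ⟨D, hD, rfl⟩ := hr
  obtain ⟨G, _, S, h⟩ := hφ.exists_areaLength
  rw [h, ← S.listProd_loop]
  exact D.len_listProd_le S hD

/-! ### Homotopies of sequences of points -/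

/-- Prepend a point to a sequence. -/
def seqCons {E : Type u} (x : E) (w : ℕ → E) : ℕ → E
  | 0 => x
  | i + 1 => w i

/-- The sequence which runs through the points of a list and stays at the last one. -/
def padSeq {E : Type u} [Zero E] : List E → ℕ → E
  | [] => fun _ => 0
  | [x] => fun _ => x
  | x :: y :: l => seqCons x (padSeq (y :: l))

theorem padSeq_eq_getD {E : Type u} [Zero E] (l : List E) (i : ℕ) :
    padSeq l i = l.getD (min i (l.length - 1)) 0 := by
  induction l generalizing i with
  | nil => simp [padSeq]
  | cons x l ih =>
    cases l with
    | nil => simp [padSeq]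
    | cons y l =>
      cases i with
      | zero => simp [padSeq, seqCons]
      | succ i =>
        rw [padSeq, seqCons, ih]
        simp only [List.length_cons, Nat.add_sub_cancel]
        rw [Nat.add_min_add_right, List.getD_cons_succ]

theorem padSeq_zero {E : Type u} [Zero E] (x : E) (l : List E) : padSeq (x :: l) 0 = x := by
  cases l <;> rfl

/-- The total area of the triangles in a strip between two sequences. -/
noncomputable def stripArea {n : ℕ} (M : ℕ) (w w' : ℕ → EuclideanSpace ℝ (Fin n)) : ℝ :=
  ∑ i ∈ Finset.range M,
    (triArea (w i) (w (i + 1)) (w' (i + 1)) + triArea (w i) (w' (i + 1)) (w' i))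

/-- `SeqHtpy M w w' c`: the sequence `w'` is obtained from `w` by moving points with positive
index less than `M`, one at a time, with total cost `c`. -/
inductive SeqHtpy {n : ℕ} (M : ℕ) :
    (ℕ → EuclideanSpace ℝ (Fin n)) → (ℕ → EuclideanSpace ℝ (Fin n)) → ℝ → Prop
  | refl (w) : SeqHtpy M w w 0
  | move (w w' : ℕ → EuclideanSpace ℝ (Fin n)) (a : ℕ) : (∀ i, i ≠ a + 1 → w' i = w i) →
      a + 2 ≤ M → SeqHtpy M w w' (triArea (w a) (w (a + 1)) (w' (a + 1)) +
        triArea (w (a + 1)) (w' (a + 1)) (w (a + 2)))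
  | trans {w w' w'' c c'} : SeqHtpy M w w' c → SeqHtpy M w' w'' c' → SeqHtpy M w w'' (c + c')

namespace SeqHtpy

variable {n M M' : ℕ} {w w' : ℕ → EuclideanSpace ℝ (Fin n)} {c : ℝ}

theorem symm (h : SeqHtpy M w w' c) : SeqHtpy M w' w c := by
  induction h with
  | refl w => exact .refl w
  | move w w' a h1 h2 =>
    have h := SeqHtpy.move w' w a (fun i hi => (h1 i hi).symm) h2
    rw [h1 a (by omega), h1 (a + 2) (by omega)] at h
    rwa [triArea_swap_right (w a), triArea_swap_left (w (a + 1))]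
  | trans _ _ h1 h2 => rw [add_comm]; exact h2.trans h1

theorem mono (h : SeqHtpy M w w' c) (hM : M ≤ M') : SeqHtpy M' w w' c := by
  induction h with
  | refl w => exact .refl w
  | move w w' a h1 h2 => exact .move w w' a h1 (h2.trans hM)
  | trans _ _ h1 h2 => exact h1.trans h2

theorem cons (x : EuclideanSpace ℝ (Fin n)) (h : SeqHtpy M w w' c) :
    SeqHtpy (M + 1) (seqCons x w) (seqCons x w') c := by
  induction h with
  | refl w => exact .refl _
  | move w w' a h1 h2 =>
    refine .move (seqCons x w) (seqCons x w') (a + 1) (fun i hi => ?_) (by omega)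
    cases i with
    | zero => rfl
    | succ i => exact h1 i (by omega)
  | trans _ _ h1 h2 => exact h1.trans h2

theorem change (x a b : EuclideanSpace ℝ (Fin n)) (w : ℕ → EuclideanSpace ℝ (Fin n)) :
    SeqHtpy 2 (seqCons x (seqCons a w)) (seqCons x (seqCons b w))
      (triArea x a b + triArea a b (w 0)) := by
  refine .move (seqCons x (seqCons a w)) (seqCons x (seqCons b w)) 0 (fun i hi => ?_) le_rfl
  match i with
  | 0 => rfl
  | 1 => exact absurd rfl hi
  | i + 2 => rfl

/-- Repeating `x` shifts the whole tail. The repetition is first made at the next point `z`; then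
the first copy of `z` moves to `x` between neighbours `x` and `z`, sweeping no area. Padding makes
the last point repeat already. -/
theorem stall (x : EuclideanSpace ℝ (Fin n)) (l : List (EuclideanSpace ℝ (Fin n))) :
    ∃ M, SeqHtpy M (padSeq (x :: l)) (padSeq (x :: x :: l)) 0 := by
  induction l generalizing x with
  | nil =>
    refine ⟨0, ?_⟩
    have h : padSeq [x, x] = padSeq [x] := by
      funext i
      cases i <;> rfl
    rw [h]
    exact .refl _
  | cons z l ih =>
    obtain ⟨M, hM⟩ := ih z
    have h := ((hM.cons x).mono (M' := M + 2) (by omega)).trans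
      ((change x z x (padSeq (z :: l))).mono (by omega))
    rw [padSeq_zero] at h
    simp only [triArea_self_outer, add_zero] at h
    exact ⟨_, h⟩

theorem append (s : List (EuclideanSpace ℝ (Fin n))) {p q : List (EuclideanSpace ℝ (Fin n))}
    (hp : p ≠ []) (hq : q ≠ []) (h : ∃ M, SeqHtpy M (padSeq p) (padSeq q) c) :
    ∃ M, SeqHtpy M (padSeq (s ++ p)) (padSeq (s ++ q)) c := by
  have hcons : ∀ (x : EuclideanSpace ℝ (Fin n)) (l : List _), l ≠ [] →
      padSeq (x :: l) = seqCons x (padSeq l) := by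
    intro x l hl
    cases l with
    | nil => exact absurd rfl hl
    | cons y l => rfl
  induction s with
  | nil => exact h
  | cons x s ih =>
    obtain ⟨M, hM⟩ := ih
    refine ⟨M + 1, ?_⟩
    rw [List.cons_append, List.cons_append, hcons _ _ (by simp [hp]), hcons _ _ (by simp [hq])]
    exact hM.cons x

/-- Padding makes lists of different lengths comparable: stalling becomes finitely many free moves,
so all rows of the later grid can have the same width. -/
theorem of_listHtpy {p q : List (EuclideanSpace ℝ (Fin n))} (h : ListHtpy p q c) :
    ∃ M, SeqHtpy M (padSeq p) (padSeq q) c := by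
  induction h with
  | refl p => exact ⟨0, .refl _⟩
  | stall l x r => exact append l (by simp) (by simp) (stall x r)
  | unstall l x r =>
    obtain ⟨M, hM⟩ := stall x r
    exact append l (by simp) (by simp) ⟨M, hM.symm⟩
  | change l x a b z r =>
    have h := change x a b (padSeq (z :: r))
    rw [padSeq_zero] at h
    exact append l (by simp) (by simp) ⟨2, h⟩
  | trans _ _ h1 h2 =>
    obtain ⟨M, hM⟩ := h1
    obtain ⟨M', hM'⟩ := h2
    exact ⟨max M M', (hM.mono (le_max_left _ _)).trans (hM'.mono (le_max_right _ _))⟩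

/-- This keeps both outer columns of the grid constant. -/
theorem eq_outside (h : SeqHtpy M w w' c) {i : ℕ} (hi : i = 0 ∨ M ≤ i) : w' i = w i := by
  induction h with
  | refl => rfl
  | move w w' a h1 h2 => exact h1 i (by omega)
  | trans _ _ h1 h2 => rw [h2, h1]

/-- Only the two squares next to the moved point contain a nondegenerate triangle, one each. -/
theorem stripArea_move (a : ℕ) (h1 : ∀ i, i ≠ a + 1 → w' i = w i) (h2 : a + 2 ≤ M) :
    stripArea M w w' = triArea (w a) (w (a + 1)) (w' (a + 1)) +
      triArea (w (a + 1)) (w' (a + 1)) (w (a + 2)) := by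
  have hsub : {a, a + 1} ⊆ Finset.range M := by
    intro i hi
    simp only [Finset.mem_insert, Finset.mem_singleton] at hi
    simp only [Finset.mem_range]
    omega
  rw [stripArea, ← Finset.sum_subset hsub, Finset.sum_pair (by omega), h1 a (by omega),
    h1 (a + 1 + 1) (by omega), triArea_self_outer, triArea_self_right, add_zero, zero_add,
    triArea_swap_right (w (a + 1))]
  intro i _ hi
  simp only [Finset.mem_insert, Finset.mem_singleton, not_or] at hi
  rw [h1 i (by omega), h1 (i + 1) (by omega), triArea_self_right, triArea_self_outer, add_zero]

/-- A homotopy of sequences can be arranged into a grid. -/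
theorem exists_grid (h : SeqHtpy M w w' c) :
    ∃ (K : ℕ) (u : ℕ → ℕ → EuclideanSpace ℝ (Fin n)), 0 < K ∧ u 0 = w ∧ u K = w' ∧
      (∀ j i, i = 0 ∨ M ≤ i → u j i = w i) ∧
      ∑ j ∈ Finset.range K, stripArea M (u j) (u (j + 1)) = c := by
  induction h with
  -- One strip is used even for the trivial homotopy, since the rectangle needs positive height.
  | refl w => exact ⟨1, fun _ => w, one_pos, rfl, rfl, fun _ _ _ => rfl, by simp [stripArea]⟩
  | move w w' a h1 h2 =>
    refine ⟨1, fun j => if j = 0 then w else w', one_pos, by simp, by simp, ?_, ?_⟩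
    · intro j i hi
      by_cases hj : j = 0
      · simp [hj]
      · simp only [hj, if_false]
        exact h1 i (by omega)
    · simp only [Finset.sum_range_one, zero_add, if_true, one_ne_zero, if_false]
      exact stripArea_move a h1 h2
  | @trans w w' w'' c c' h h' ih ih' =>
    obtain ⟨K, u, hK, hu0, huK, hu, hs⟩ := ih
    obtain ⟨K', u', hK', hu0', huK', hu', hs'⟩ := ih'
    refine ⟨K + K', fun j => if j ≤ K then u j else u' (j - K), by omega, by simp [hu0], ?_, ?_, ?_⟩
    · have h1 : ¬ K + K' ≤ K := by omega
      simp [h1, huK']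
    · intro j i hi
      by_cases hj : j ≤ K
      · simp only [hj, if_true]
        exact hu j i hi
      · simp only [hj, if_false]
        rw [hu' _ i hi, h.eq_outside hi]
    · rw [Finset.sum_range_add, ← hs, ← hs']
      congr 1
      · refine Finset.sum_congr rfl fun j hj => ?_
        have := Finset.mem_range.1 hj
        beta_reduce
        rw [if_pos (by omega), if_pos (by omega)]
      · refine Finset.sum_congr rfl fun j hj => ?_
        beta_reduce
        rw [if_neg (by omega : ¬ K + j + 1 ≤ K)]
        have h2 : K + j + 1 - K = j + 1 := by omega
        rw [h2]
        congr 1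
        -- At the seam the row is `u K`, which is also the first row of the second grid.
        by_cases hj0 : j = 0
        · subst hj0
          simp [huK, hu0']
        · rw [if_neg (by omega)]
          congr 1
          omega

end SeqHtpy

/-! ### Piecewise linear maps on a grid -/

section grid

variable {E : Type u} [AddCommGroup E] [Module ℝ E]

/-- A point of the plane. -/
def planePt (x y : ℝ) : EuclideanSpace ℝ (Fin 2) := !₂[x, y]

@[simp] theorem planePt_zero (x y : ℝ) : planePt x y 0 = x := rfl

@[simp] theorem planePt_one (x y : ℝ) : planePt x y 1 = y := rfl

theorem plane_ext {p q : EuclideanSpace ℝ (Fin 2)} (h0 : p 0 = q 0) (h1 : p 1 = q 1) : p = q := by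
  ext i
  fin_cases i
  exacts [h0, h1]

/-- The map which sends the grid point `(i, j)` to `w j i` and is affine on the two triangles
into which each unit square is cut by its rising diagonal. -/
noncomputable def gridMap (w : ℕ → ℕ → E) (p : EuclideanSpace ℝ (Fin 2)) : E :=
  let i := ⌊p 0⌋₊
  let j := ⌊p 1⌋₊
  let a := Int.fract (p 0)
  let b := Int.fract (p 1)
  if b ≤ a then w j i + a • (w j (i + 1) - w j i) + b • (w (j + 1) (i + 1) - w j (i + 1))
  else w j i + b • (w (j + 1) i - w j i) + a • (w (j + 1) (i + 1) - w (j + 1) i)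

theorem floor_fract_of_lt {x : ℝ} {i : ℕ} (h : (i : ℝ) ≤ x) (h' : x < i + 1) :
    ⌊x⌋₊ = i ∧ Int.fract x = x - i := by
  refine ⟨(Nat.floor_eq_iff ((Nat.cast_nonneg i).trans h)).2 ⟨h, h'⟩, ?_⟩
  rw [Int.fract_eq_iff]
  exact ⟨by linarith, by linarith, i, by simp⟩

/-- The closed triangle touches the lines where the floors jump to the next cell; the separate cases
check that the formulas agree there. -/
theorem gridMap_of_lower (w : ℕ → ℕ → E) {i j : ℕ} {p : EuclideanSpace ℝ (Fin 2)}
    (h1 : p 0 ≤ i + 1) (h2 : (j : ℝ) ≤ p 1) (h3 : p 1 - j ≤ p 0 - i) :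
    gridMap w p = w j i + (p 0 - i) • (w j (i + 1) - w j i) +
      (p 1 - j) • (w (j + 1) (i + 1) - w j (i + 1)) := by
  rcases h1.eq_or_lt with h1 | h1
  · obtain ⟨f1, f2⟩ := floor_fract_of_lt (i := i + 1) (x := p 0) (by push_cast; linarith)
      (by push_cast; linarith)
    have e1 : p 0 - i = 1 := by linarith
    rcases (show p 1 ≤ j + 1 by linarith).eq_or_lt with h4 | h4
    · obtain ⟨g1, g2⟩ := floor_fract_of_lt (i := j + 1) (x := p 1) (by push_cast; linarith)
        (by push_cast; linarith)
      have e2 : p 1 - j = 1 := by linarith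
      simp only [gridMap, f1, f2, g1, g2, e1, e2]
      simp [h1, h4]
    · obtain ⟨g1, g2⟩ := floor_fract_of_lt (i := j) (x := p 1) h2 h4
      simp only [gridMap, f1, f2, g1, g2, e1]
      push_cast
      simp only [h1, sub_self, zero_smul, one_smul, add_zero]
      split_ifs with h5
      · rw [le_antisymm h5 (by linarith : 0 ≤ p 1 - j)]
        simp
      · abel
  · obtain ⟨f1, f2⟩ := floor_fract_of_lt (i := i) (x := p 0) (by linarith) h1
    obtain ⟨g1, g2⟩ := floor_fract_of_lt (i := j) (x := p 1) h2 (by linarith)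
    simp only [gridMap, f1, f2, g1, g2, h3, if_true]

theorem gridMap_of_upper (w : ℕ → ℕ → E) {i j : ℕ} {p : EuclideanSpace ℝ (Fin 2)}
    (h1 : (i : ℝ) ≤ p 0) (h2 : p 1 ≤ j + 1) (h3 : p 0 - i ≤ p 1 - j) :
    gridMap w p = w j i + (p 1 - j) • (w (j + 1) i - w j i) +
      (p 0 - i) • (w (j + 1) (i + 1) - w (j + 1) i) := by
  rcases h2.eq_or_lt with h2 | h2
  · obtain ⟨g1, g2⟩ := floor_fract_of_lt (i := j + 1) (x := p 1) (by push_cast; linarith)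
      (by push_cast; linarith)
    have e2 : p 1 - j = 1 := by linarith
    rcases (show p 0 ≤ i + 1 by linarith).eq_or_lt with h4 | h4
    · obtain ⟨f1, f2⟩ := floor_fract_of_lt (i := i + 1) (x := p 0) (by push_cast; linarith)
        (by push_cast; linarith)
      have e1 : p 0 - i = 1 := by linarith
      simp only [gridMap, f1, f2, g1, g2, e1, e2]
      simp [h2, h4]
    · obtain ⟨f1, f2⟩ := floor_fract_of_lt (i := i) (x := p 0) h1 h4
      have h5 : 0 ≤ p 0 - i := by linarith
      have h6 : p 1 - (j + 1 : ℕ) = 0 := by push_cast; linarith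
      simp only [gridMap, f1, f2, g1, g2, e2, h6, h5, if_true]
      simp
  · obtain ⟨f1, f2⟩ := floor_fract_of_lt (i := i) (x := p 0) h1 (by linarith)
    obtain ⟨g1, g2⟩ := floor_fract_of_lt (i := j) (x := p 1) (by linarith) h2
    simp only [gridMap, f1, f2, g1, g2]
    split_ifs with h4
    · have h5 : p 1 - j = p 0 - i := le_antisymm h4 h3
      rw [h5]
      module
    · rfl

theorem gridMap_row (w : ℕ → ℕ → E) (x : ℝ) (j : ℕ) :
    gridMap w (planePt x j) = plCurve (w j) x := by
  simp only [gridMap, planePt_zero, planePt_one, Nat.floor_natCast, Int.fract_natCast,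
    Int.fract_nonneg, if_true, plCurve, AffineMap.lineMap_apply_module']
  module

theorem gridMap_column (w : ℕ → ℕ → E) (i : ℕ) (y : ℝ) :
    gridMap w (planePt i y) = plCurve (fun j => w j i) y := by
  simp only [gridMap, planePt_zero, planePt_one, Nat.floor_natCast, Int.fract_natCast, plCurve,
    AffineMap.lineMap_apply_module']
  split_ifs with h
  · rw [le_antisymm h (Int.fract_nonneg _)]
    simp
  · module

/-- The affine map with prescribed linear part in coordinates. -/
theorem exists_affineMap (c a b : E) (x y : ℝ) :
    ∃ A : EuclideanSpace ℝ (Fin 2) →ᵃ[ℝ] E, ∀ p, A p = c + (p 0 - x) • a + (p 1 - y) • b := by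
  refine ⟨{ toFun := fun p => c + (p 0 - x) • a + (p 1 - y) • b
            linear :=
              { toFun := fun p => p 0 • a + p 1 • b
                map_add' := fun p q => by simp only [PiLp.add_apply]; module
                map_smul' := fun r p => by
                  simp only [PiLp.smul_apply, smul_eq_mul, RingHom.id_apply]; module }
            map_vadd' := fun p v => ?_ }, fun p => rfl⟩
  simp only [vadd_eq_add, PiLp.add_apply, LinearMap.coe_mk, AddHom.coe_mk]
  module

/-- One of the two triangles of a unit square. -/
def gridTri (i j : ℕ) (lower : Bool) : Fin 3 → EuclideanSpace ℝ (Fin 2) :=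
  if lower then ![planePt i j, planePt (i + 1) j, planePt (i + 1) (j + 1)]
  else ![planePt i j, planePt (i + 1) (j + 1), planePt i (j + 1)]

theorem range_fin_three {α : Type*} (a b c : α) : range ![a, b, c] = {a, b, c} := by
  ext x
  simp only [Matrix.range_cons, Matrix.range_empty, union_empty, mem_union, mem_singleton_iff,
    mem_insert_iff]

theorem mem_gridTri_lower {i j : ℕ} {p : EuclideanSpace ℝ (Fin 2)} :
    p ∈ convexHull ℝ (range (gridTri i j true)) ↔
      p 0 ≤ i + 1 ∧ (j : ℝ) ≤ p 1 ∧ p 1 - j ≤ p 0 - i := by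
  rw [gridTri, if_pos rfl, range_fin_three, mem_convexHull_triple]
  constructor
  · rintro ⟨a, b, c, ha, hb, hc, habc, rfl⟩
    obtain rfl : a = 1 - b - c := by linarith
    simp only [PiLp.add_apply, PiLp.smul_apply, planePt_zero, planePt_one, smul_eq_mul]
    exact ⟨by nlinarith, by nlinarith, by nlinarith⟩
  · rintro ⟨h1, h2, h3⟩
    refine ⟨1 - (p 0 - i), (p 0 - i) - (p 1 - j), p 1 - j, by linarith, by linarith, by linarith,
      by ring, plane_ext ?_ ?_⟩ <;>
    simp only [PiLp.add_apply, PiLp.smul_apply, planePt_zero, planePt_one, smul_eq_mul] <;> ring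

theorem mem_gridTri_upper {i j : ℕ} {p : EuclideanSpace ℝ (Fin 2)} :
    p ∈ convexHull ℝ (range (gridTri i j false)) ↔
      (i : ℝ) ≤ p 0 ∧ p 1 ≤ j + 1 ∧ p 0 - i ≤ p 1 - j := by
  rw [gridTri, if_neg (by simp), range_fin_three, mem_convexHull_triple]
  constructor
  · rintro ⟨a, b, c, ha, hb, hc, habc, rfl⟩
    obtain rfl : a = 1 - b - c := by linarith
    simp only [PiLp.add_apply, PiLp.smul_apply, planePt_zero, planePt_one, smul_eq_mul]
    exact ⟨by nlinarith, by nlinarith, by nlinarith⟩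
  · rintro ⟨h1, h2, h3⟩
    refine ⟨1 - (p 1 - j), p 0 - i, (p 1 - j) - (p 0 - i), by linarith, by linarith, by linarith,
      by ring, plane_ext ?_ ?_⟩ <;>
    simp only [PiLp.add_apply, PiLp.smul_apply, planePt_zero, planePt_one, smul_eq_mul] <;> ring

theorem affineIndependent_of_orient {p q r : EuclideanSpace ℝ (Fin 2)} (h : orient p q r ≠ 0) :
    AffineIndependent ℝ ![p, q, r] := by
  rw [affineIndependent_iff_not_collinear_set]
  intro hc
  obtain ⟨v, hv⟩ := (collinear_iff_of_mem (p₀ := p) (by simp)).1 hc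
  obtain ⟨a, ha⟩ := hv q (by simp)
  obtain ⟨b, hb⟩ := hv r (by simp)
  refine h ?_
  simp only [orient, ha, hb, vadd_eq_add, PiLp.add_apply, PiLp.smul_apply, smul_eq_mul]
  ring

theorem affineIndependent_gridTri (i j : ℕ) (lower : Bool) :
    AffineIndependent ℝ (gridTri i j lower) := by
  cases lower
  · rw [gridTri, if_neg (by simp)]
    exact affineIndependent_of_orient (by simp [orient])
  · rw [gridTri, if_pos rfl]
    exact affineIndependent_of_orient (by simp [orient])

theorem exists_pos_add_smul_mem {V : Type*} [NormedAddCommGroup V] [NormedSpace ℝ V] {S : Set V}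
    {p : V} (h : p ∈ interior S) (v : V) : ∃ t : ℝ, 0 < t ∧ p + t • v ∈ S := by
  have hc : Filter.Tendsto (fun t : ℝ => p + t • v) (nhdsWithin 0 (Ioi 0)) (nhds p) := by
    have h1 : Continuous fun t : ℝ => p + t • v := by fun_prop
    have h2 := h1.tendsto 0
    simp only [zero_smul, add_zero] at h2
    exact h2.mono_left nhdsWithin_le_nhds
  have h3 := hc.eventually (mem_interior_iff_mem_nhds.1 h)
  obtain ⟨t, ht, ht'⟩ := (h3.and self_mem_nhdsWithin).exists
  exact ⟨t, ht', ht⟩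

/-- The position of an interior point of a grid triangle. -/
theorem position_of_mem_interior {i j : ℕ} {lower : Bool} {p : EuclideanSpace ℝ (Fin 2)}
    (h : p ∈ interior (convexHull ℝ (range (gridTri i j lower)))) :
    ((i : ℝ) < p 0 ∧ p 0 < i + 1) ∧ ((j : ℝ) < p 1 ∧ p 1 < j + 1) ∧
      (if lower then p 1 - j < p 0 - i else p 0 - i < p 1 - j) := by
  obtain ⟨t, ht, h1⟩ := exists_pos_add_smul_mem h (planePt 1 (-1))
  obtain ⟨s, hs, h2⟩ := exists_pos_add_smul_mem h (planePt (-1) 1)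
  obtain ⟨r, hr, h3⟩ := exists_pos_add_smul_mem h (planePt 1 0)
  obtain ⟨r', hr', h4⟩ := exists_pos_add_smul_mem h (planePt (-1) 0)
  obtain ⟨q, hq, h5⟩ := exists_pos_add_smul_mem h (planePt 0 1)
  obtain ⟨q', hq', h6⟩ := exists_pos_add_smul_mem h (planePt 0 (-1))
  cases lower
  · rw [mem_gridTri_upper] at h1 h2 h3 h4 h5 h6
    simp only [PiLp.add_apply, PiLp.smul_apply, planePt_zero, planePt_one, smul_eq_mul] at *
    simp only [Bool.false_eq_true, if_false]
    exact ⟨⟨by linarith, by linarith⟩, ⟨by linarith, by linarith⟩, by linarith⟩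
  · rw [mem_gridTri_lower] at h1 h2 h3 h4 h5 h6
    simp only [PiLp.add_apply, PiLp.smul_apply, planePt_zero, planePt_one, smul_eq_mul] at *
    simp only [if_true]
    exact ⟨⟨by linarith, by linarith⟩, ⟨by linarith, by linarith⟩, by linarith⟩

theorem nat_eq_of_between {i i' : ℕ} {x : ℝ} (h : (i : ℝ) < x ∧ x < i + 1)
    (h' : (i' : ℝ) < x ∧ x < i' + 1) : i = i' := by
  have h1 : (i : ℝ) < (i' + 1 : ℕ) := by push_cast; linarith
  have h2 : (i' : ℝ) < (i + 1 : ℕ) := by push_cast; linarith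
  have h3 := Nat.cast_lt.1 h1
  have h4 := Nat.cast_lt.1 h2
  omega

/-- Interior points have strict inequalities, so the coordinates determine the square and the side
of the diagonal determines the half. -/
theorem gridTri_eq_of_interior {i j i' j' : ℕ} {l l' : Bool} {p : EuclideanSpace ℝ (Fin 2)}
    (h : p ∈ interior (convexHull ℝ (range (gridTri i j l))))
    (h' : p ∈ interior (convexHull ℝ (range (gridTri i' j' l')))) :
    i = i' ∧ j = j' ∧ l = l' := by
  obtain ⟨h1, h2, h3⟩ := position_of_mem_interior h
  obtain ⟨h1', h2', h3'⟩ := position_of_mem_interior h'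
  obtain rfl := nat_eq_of_between h1 h1'
  obtain rfl := nat_eq_of_between h2 h2'
  refine ⟨rfl, rfl, ?_⟩
  cases l <;> cases l' <;> simp_all <;> linarith

/-- The corners of a rectangle. -/
def rectVertex (a b : ℝ) : Fin 4 → EuclideanSpace ℝ (Fin 2) :=
  ![planePt 0 0, planePt a 0, planePt a b, planePt 0 b]

theorem convexHull_rectVertex {a b : ℝ} (ha : 0 < a) (hb : 0 < b) :
    convexHull ℝ (range (rectVertex a b)) = {p | (0 ≤ p 0 ∧ p 0 ≤ a) ∧ (0 ≤ p 1 ∧ p 1 ≤ b)} := by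
  apply subset_antisymm
  · refine convexHull_min ?_ ?_
    · rintro _ ⟨k, rfl⟩
      fin_cases k <;> simp [rectVertex, ha.le, hb.le]
    · intro p hp q hq s t hs ht hst
      obtain rfl : s = 1 - t := by linarith
      simp only [mem_ofPred_eq, PiLp.add_apply, PiLp.smul_apply, smul_eq_mul] at *
      exact ⟨⟨by nlinarith, by nlinarith⟩, ⟨by nlinarith, by nlinarith⟩⟩
  · rintro p ⟨⟨h1, h2⟩, ⟨h3, h4⟩⟩
    have hx0 : 0 ≤ p 0 / a := by positivity
    have hx1 : p 0 / a ≤ 1 := (div_le_one ha).2 h2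
    have hy0 : 0 ≤ p 1 / b := by positivity
    have hy1 : p 1 / b ≤ 1 := (div_le_one hb).2 h4
    -- The weights are the bilinear coordinates of the point in the rectangle.
    have h := (convex_convexHull ℝ (range (rectVertex a b))).sum_mem (t := Finset.univ)
      (w := ![(1 - p 0 / a) * (1 - p 1 / b), p 0 / a * (1 - p 1 / b), p 0 / a * (p 1 / b),
        (1 - p 0 / a) * (p 1 / b)]) (z := rectVertex a b)
      (by
        intro k _
        fin_cases k
        · exact mul_nonneg (sub_nonneg.2 hx1) (sub_nonneg.2 hy1)
        · exact mul_nonneg hx0 (sub_nonneg.2 hy1)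
        · exact mul_nonneg hx0 hy0
        · exact mul_nonneg (sub_nonneg.2 hx1) hy0)
      (by simp [Fin.sum_univ_four]; ring)
      (fun k _ => subset_convexHull ℝ _ (mem_range_self k))
    convert h using 1
    rw [Fin.sum_univ_four]
    apply plane_ext <;>
      simp [rectVertex] <;> field_simp <;> ring

theorem iUnion_gridTri {M K : ℕ} (hM : 0 < M) (hK : 0 < K) :
    ⋃ s : Fin M × Fin K × Bool, convexHull ℝ (range (gridTri s.1 s.2.1 s.2.2)) =
      convexHull ℝ (range (rectVertex M K)) := by
  rw [convexHull_rectVertex (by exact_mod_cast hM) (by exact_mod_cast hK)]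
  ext p
  simp only [mem_iUnion, Prod.exists, mem_ofPred_eq]
  constructor
  · rintro ⟨i, j, l, h⟩
    have hi : (i : ℝ) + 1 ≤ M := by exact_mod_cast i.2
    have hj : (j : ℝ) + 1 ≤ K := by exact_mod_cast j.2
    have hi0 : (0 : ℝ) ≤ i := Nat.cast_nonneg _
    have hj0 : (0 : ℝ) ≤ j := Nat.cast_nonneg _
    cases l
    · rw [mem_gridTri_upper] at h
      exact ⟨⟨by linarith, by linarith⟩, ⟨by linarith, by linarith⟩⟩
    · rw [mem_gridTri_lower] at h
      exact ⟨⟨by linarith, by linarith⟩, ⟨by linarith, by linarith⟩⟩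
  · rintro ⟨⟨h1, h2⟩, ⟨h3, h4⟩⟩
    have key : ∀ {N : ℕ} {x : ℝ}, 0 < N → 0 ≤ x → x ≤ N →
        ∃ i : Fin N, (i : ℝ) ≤ x ∧ x ≤ i + 1 := by
      intro N x hN hx hxN
      rcases hxN.eq_or_lt with rfl | hlt
      -- The right end belongs to the last cell, whereas its floor would be out of range.
      · refine ⟨⟨N - 1, by omega⟩, ?_⟩
        simp [Nat.cast_sub (show 1 ≤ N by omega)]
      · exact ⟨⟨⌊x⌋₊, (Nat.floor_lt hx).2 hlt⟩, Nat.floor_le hx, (Nat.lt_floor_add_one x).le⟩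
    obtain ⟨i, hi, hi'⟩ := key hM h1 h2
    obtain ⟨j, hj, hj'⟩ := key hK h3 h4
    rcases le_total (p 1 - j) (p 0 - i) with h | h
    · exact ⟨i, j, true, mem_gridTri_lower.2 ⟨hi', hj, h⟩⟩
    · exact ⟨i, j, false, mem_gridTri_upper.2 ⟨hi, hj', h⟩⟩

theorem exists_affine_gridMap (w : ℕ → ℕ → E) (i j : ℕ) (l : Bool) :
    ∃ A : EuclideanSpace ℝ (Fin 2) →ᵃ[ℝ] E,
      EqOn (gridMap w) A (convexHull ℝ (range (gridTri i j l))) := by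
  cases l
  · obtain ⟨A, hA⟩ := exists_affineMap (w j i) (w (j + 1) (i + 1) - w (j + 1) i)
      (w (j + 1) i - w j i) i j
    refine ⟨A, fun p hp => ?_⟩
    obtain ⟨h1, h2, h3⟩ := mem_gridTri_upper.1 hp
    rw [hA, gridMap_of_upper w h1 h2 h3, add_right_comm]
  · obtain ⟨A, hA⟩ := exists_affineMap (w j i) (w j (i + 1) - w j i)
      (w (j + 1) (i + 1) - w j (i + 1)) i j
    refine ⟨A, fun p hp => ?_⟩
    obtain ⟨h1, h2, h3⟩ := mem_gridTri_lower.1 hp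
    rw [hA, gridMap_of_lower w h1 h2 h3]

end grid

/-- The piecewise linear disk on a rectangular grid with prescribed values at the grid points. -/
noncomputable def gridDisk {n : ℕ} (M K : ℕ) (hM : 0 < M) (hK : 0 < K)
    (w : ℕ → ℕ → EuclideanSpace ℝ (Fin n)) : PLDisk n :=
  let e := Fintype.equivFin (Fin M × Fin K × Bool)
  have hM' : (0 : ℝ) < M := by exact_mod_cast hM
  have hK' : (0 : ℝ) < K := by exact_mod_cast hK
  { m := 4
    vertex := rectVertex M K
    vertex_injective := by
      have h01 : ∀ {x y x' y' : ℝ}, planePt x y = planePt x' y' → x = x' ∧ y = y' := fun h =>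
        ⟨congrArg (fun p => p 0) h, congrArg (fun p => p 1) h⟩
      intro a b hab
      fin_cases a <;> fin_cases b <;> first
        | rfl
        | (exfalso
           obtain ⟨h0, h1⟩ := h01 hab
           linarith)
    counterclockwise := by
      intro i j k hij hjk
      fin_cases i <;> fin_cases j <;> fin_cases k <;> first
        | (exfalso; revert hij hjk; decide)
        | (simp [rectVertex, orient]; done)
        | (simp [rectVertex, orient]; positivity)
    interior_nonempty := by
      rw [convexHull_rectVertex hM' hK']
      have hU : IsOpen {p : EuclideanSpace ℝ (Fin 2) | (0 < p 0 ∧ p 0 < M) ∧ (0 < p 1 ∧ p 1 < K)} := by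
        have h : ∀ i : Fin 2, Continuous fun x : EuclideanSpace ℝ (Fin 2) => x i := by fun_prop
        exact ((isOpen_lt continuous_const (h 0)).inter (isOpen_lt (h 0) continuous_const)).inter
          ((isOpen_lt continuous_const (h 1)).inter (isOpen_lt (h 1) continuous_const))
      refine ⟨planePt (M / 2) (K / 2), interior_maximal ?_ hU ?_⟩
      · rintro p ⟨⟨h1, h2⟩, ⟨h3, h4⟩⟩
        exact ⟨⟨h1.le, h2.le⟩, ⟨h3.le, h4.le⟩⟩
      · simp [hM', hK']
    map := gridMap w
    N := Fintype.card (Fin M × Fin K × Bool)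
    tri := fun s => gridTri (e.symm s).1 (e.symm s).2.1 (e.symm s).2.2
    tri_nondegenerate := fun s => affineIndependent_gridTri _ _ _
    tri_disjoint := by
      intro s t hst
      rw [Set.disjoint_left]
      intro p hs ht
      obtain ⟨h1, h2, h3⟩ := gridTri_eq_of_interior hs ht
      exact hst (e.symm.injective (Prod.ext (Fin.ext h1) (Prod.ext (Fin.ext h2) h3)))
    tri_cover := by
      rw [← iUnion_gridTri hM hK]
      exact e.symm.surjective.iUnion_comp
        (fun s : Fin M × Fin K × Bool => convexHull ℝ (range (gridTri s.1 s.2.1 s.2.2)))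
    map_affine := fun s => exists_affine_gridMap w _ _ _ }

section gridDisk

variable {n M K : ℕ} (hM : 0 < M) (hK : 0 < K) (w : ℕ → ℕ → EuclideanSpace ℝ (Fin n))

theorem gridMap_natCast (i j : ℕ) : gridMap w (planePt i j) = w j i := by
  rw [gridMap_row, plCurve_natCast]

/-- All corners are grid points, and the two halves of a unit square give the two terms of a summand
in `stripArea`. -/
theorem area_gridDisk : (gridDisk M K hM hK w).area =
    ∑ j ∈ Finset.range K, stripArea M (w j) (w (j + 1)) := by
  let F : Fin M × Fin K × Bool → ℝ := fun s => triArea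
    (gridMap w (gridTri s.1 s.2.1 s.2.2 0)) (gridMap w (gridTri s.1 s.2.1 s.2.2 1))
    (gridMap w (gridTri s.1 s.2.1 s.2.2 2))
  have h : (gridDisk M K hM hK w).area = ∑ s, F s :=
    (Fintype.equivFin (Fin M × Fin K × Bool)).symm.sum_comp F
  have h1 : ∀ i j : ℕ, gridMap w (planePt (i + 1) j) = w j (i + 1) := fun i j => by
    exact_mod_cast gridMap_natCast w (i + 1) j
  have h2 : ∀ i j : ℕ, gridMap w (planePt i (j + 1)) = w (j + 1) i := fun i j => by
    exact_mod_cast gridMap_natCast w i (j + 1)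
  have h3 : ∀ i j : ℕ, gridMap w (planePt (i + 1) (j + 1)) = w (j + 1) (i + 1) := fun i j => by
    exact_mod_cast gridMap_natCast w (i + 1) (j + 1)
  rw [h, Fintype.sum_prod_type]
  simp only [Fintype.sum_prod_type, Fintype.sum_bool, F, gridTri, if_true, Bool.false_eq_true,
    if_false, Matrix.cons_val, gridMap_natCast, h1, h2, h3]
  rw [Finset.sum_comm, Finset.sum_range]
  refine Finset.sum_congr rfl fun j _ => ?_
  rw [stripArea, Finset.sum_range]

theorem boundary_gridDisk (t : ℝ) : (gridDisk M K hM hK w).boundary t =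
    gridMap w (plCurve (fun i => [planePt 0 0, planePt M 0, planePt M K, planePt 0 K,
      planePt 0 0].getD i 0) (4 * t)) := by
  have h : List.ofFn (gridDisk M K hM hK w).vertex ++
      (List.ofFn (gridDisk M K hM hK w).vertex).take 1 =
      [planePt 0 0, planePt M 0, planePt M K, planePt 0 K, planePt 0 0] := by
    change List.ofFn (rectVertex M K) ++ (List.ofFn (rectVertex M K)).take 1 = _
    simp [rectVertex, List.ofFn_succ]
  rw [PLDisk.boundary, PLDisk.domainBoundary, h, polyline_eq_plCurve]
  norm_num
  rfl

end gridDisk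

/-! ### The boundary of a grid disk -/

section plCurve

variable {E : Type u} [AddCommGroup E] [Module ℝ E]

/-- Beyond `k` the points repeat, so the curve is constant there. This describes the padded part of
a row. -/
theorem plCurve_min {w w' : ℕ → E} {k : ℕ} (h : ∀ i, w i = w' (min i k)) {x : ℝ} (hx : 0 ≤ x) :
    plCurve w x = plCurve w' (min x k) := by
  have h1 := Nat.floor_le hx
  have h2 := (Nat.lt_floor_add_one x).le
  rw [plCurve_eq_lineMap w _ h1 h2]
  rcases lt_or_ge ⌊x⌋₊ k with h3 | h3
  · have h4 : x ≤ k := h2.trans (by exact_mod_cast h3)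
    rw [min_eq_left h4, plCurve_eq_lineMap w' _ h1 h2, h, h, min_eq_left h3.le, min_eq_left h3]
  · have h4 : (k : ℝ) ≤ x := le_trans (by exact_mod_cast h3) h1
    rw [min_eq_right h4, plCurve_natCast, h, h, min_eq_right h3, min_eq_right (h3.trans (by simp)),
      AffineMap.lineMap_same_apply]

theorem plCurve_const {w : ℕ → E} {x : E} (h : ∀ i, w i = x) (t : ℝ) : plCurve w t = x := by
  rw [plCurve, h, h, AffineMap.lineMap_same_apply]

theorem plCurve_reverse (w : ℕ → E) {N : ℕ} {x : ℝ} (hx : 0 ≤ x) (hN : x ≤ N) :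
    plCurve (fun i => w (N - i)) x = plCurve w (N - x) := by
  have h1 := Nat.floor_le hx
  have h2 := (Nat.lt_floor_add_one x).le
  rcases hN.eq_or_lt with rfl | hlt
  · rw [plCurve_natCast, sub_self, Nat.sub_self]
    exact_mod_cast (plCurve_natCast w 0).symm
  have h3 : ⌊x⌋₊ + 1 ≤ N := (Nat.floor_lt hx).2 hlt
  have hc : ((N - (⌊x⌋₊ + 1) : ℕ) : ℝ) = N - (⌊x⌋₊ + 1) := by
    rw [Nat.cast_sub h3]
    push_cast
    ring
  rw [plCurve_eq_lineMap _ _ h1 h2, plCurve_eq_lineMap w (N - (⌊x⌋₊ + 1)) (by rw [hc]; linarith)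
    (by rw [hc]; linarith), show N - (⌊x⌋₊ + 1) + 1 = N - ⌊x⌋₊ by omega, hc,
    AffineMap.lineMap_apply_module, AffineMap.lineMap_apply_module]
  module

end plCurve

/-- The boundary of a grid disk whose bottom row runs through `p`, whose top row runs through `q`,
and whose outer columns are constant. -/
theorem samePath_gridDisk {n M K : ℕ} (hM : 0 < M) (hK : 0 < K)
    {w : ℕ → ℕ → EuclideanSpace ℝ (Fin n)} {L : List (EuclideanSpace ℝ (Fin n))} {k l : ℕ}
    (hL : L.length - 1 = k + l) (hkM : k ≤ M) (hlM : l ≤ M)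
    (h0 : ∀ i, w 0 i = L.getD (min i k) 0) (h1 : ∀ i, w K i = L.getD (k + l - min i l) 0)
    (hl : ∀ j, w j 0 = L.getD 0 0) (hr : ∀ j, w j M = L.getD k 0) :
    SamePath (gridDisk M K hM hK w).boundary (polyline L) := by
  have hM' : (0 : ℝ) < M := by exact_mod_cast hM
  have hK' : (0 : ℝ) < K := by exact_mod_cast hK
  have hkM' : (k : ℝ) ≤ M := by exact_mod_cast hkM
  have hlM' : (l : ℝ) ≤ M := by exact_mod_cast hlM
  have hk0 : (0 : ℝ) ≤ k := Nat.cast_nonneg _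
  have hl0 : (0 : ℝ) ≤ l := Nat.cast_nonneg _
  -- The constant left column forces the boundary list to be closed.
  have hwL : L.getD 0 0 = L.getD (k + l) 0 := by
    have h2 := h1 0
    rw [hl, Nat.zero_min, Nat.sub_zero] at h2
    exact h2
  -- The number of edges of `L` traversed at time `t`: `k` on the bottom side and `l` on the top
  -- side, each taking a quarter of the time. The clamps hold it fixed on the vertical sides and on
  -- the padding.
  let τ : ℝ → ℝ := fun t => min (M * (4 * t)) k + (l - min (max (M * (3 - 4 * t)) 0) l)
  have hτc : Continuous τ := by fun_prop
  have hτm : Monotone τ := by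
    intro s t hst
    have h2 : (M : ℝ) * (4 * s) ≤ M * (4 * t) := mul_le_mul_of_nonneg_left (by linarith) hM'.le
    have h3 : (M : ℝ) * (3 - 4 * t) ≤ M * (3 - 4 * s) :=
      mul_le_mul_of_nonneg_left (by linarith) hM'.le
    exact add_le_add (min_le_min_right _ h2)
      (sub_le_sub_left (min_le_min_right _ (max_le_max_right _ h3)) _)
  have hτ0 : τ 0 = 0 := by
    have h2 : (l : ℝ) ≤ max ((M : ℝ) * (3 - 4 * 0)) 0 := le_max_of_le_left (by nlinarith)
    simp only [τ, min_eq_right h2]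
    simp
  have hτ1 : τ 1 = k + l := by
    have h2 : (k : ℝ) ≤ M * (4 * 1) := by nlinarith
    have h3 : (M : ℝ) * (3 - 4 * 1) ≤ 0 := by nlinarith
    simp only [τ, min_eq_right h2, max_eq_right h3, min_eq_left hl0]
    ring
  obtain ⟨β, hβc, hβm, hβ0, hβ1, hβ⟩ : ∃ β : ℝ → ℝ, Continuous β ∧ Monotone β ∧ β 0 = 0 ∧
      β 1 = 1 ∧ ∀ t ∈ Icc (0 : ℝ) 1, ((k + l : ℕ) : ℝ) * β t = τ t := by
    -- Normalizing `τ` divides by the number of edges; with no edges `τ` vanishes on the unit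
    -- interval and any reparametrization serves.
    by_cases hkl : k + l = 0
    · refine ⟨id, continuous_id, monotone_id, rfl, rfl, fun t ht => ?_⟩
      have h2 := hτm ht.1
      have h3 := hτm ht.2
      have h4 : (k : ℝ) + l = 0 := by exact_mod_cast hkl
      rw [hkl, Nat.cast_zero, zero_mul]
      linarith
    · have hne : ((k + l : ℕ) : ℝ) ≠ 0 := by exact_mod_cast hkl
      refine ⟨fun t => τ t / (k + l : ℕ), hτc.div_const _,
        fun s t hst => div_le_div_of_nonneg_right (hτm hst) (Nat.cast_nonneg _), by simp [hτ0],
        ?_, fun t _ => mul_div_cancel₀ _ hne⟩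
      beta_reduce
      rw [hτ1, ← Nat.cast_add, div_self hne]
  refine ⟨id, β, ⟨continuousOn_id, monotoneOn_id, rfl, rfl⟩,
    ⟨hβc.continuousOn, hβm.monotoneOn _, hβ0, hβ1⟩, fun t ht => ?_⟩
  rw [id, boundary_gridDisk, polyline_eq_plCurve, hL, hβ t ht]
  have hrow0 : ∀ x : ℝ, gridMap w (planePt x 0) = plCurve (w 0) x := fun x => by
    exact_mod_cast gridMap_row w x 0
  have hcol0 : ∀ y : ℝ, gridMap w (planePt 0 y) = plCurve (fun j => w j 0) y := fun y => by
    exact_mod_cast gridMap_column w 0 y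
  have hseg : ∀ {a b a' b' s x y : ℝ}, x = a + s * (a' - a) → y = b + s * (b' - b) →
      AffineMap.lineMap (planePt a b) (planePt a' b') s = planePt x y := by
    intro a b a' b' s x y hx hy
    rw [AffineMap.lineMap_apply_module]
    apply plane_ext <;>
      simp only [PiLp.add_apply, PiLp.smul_apply, planePt_zero, planePt_one, smul_eq_mul, hx, hy] <;>
      ring
  obtain ⟨ht0, ht1⟩ := ht
  rcases le_total (4 * t) 1 with c1 | c1
  · have e1 : (l : ℝ) ≤ max (M * (3 - 4 * t)) 0 := le_max_of_le_left (by nlinarith)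
    rw [plCurve_eq_lineMap _ 0 (by simpa using ht0) (by simpa using c1)]
    simp only [List.getD_cons_zero, List.getD_cons_succ]
    rw [hseg (x := M * (4 * t)) (y := 0) (by simp; ring) (by simp), hrow0,
      plCurve_min (w' := fun i => L.getD i 0) h0 (by positivity)]
    simp only [τ, min_eq_right e1, sub_self, add_zero]
  have e0 : (k : ℝ) ≤ M * (4 * t) := by nlinarith
  rcases le_total (4 * t) 2 with c2 | c2
  · have e1 : (l : ℝ) ≤ max (M * (3 - 4 * t)) 0 := le_max_of_le_left (by nlinarith)
    rw [plCurve_eq_lineMap _ 1 (by simpa using c1) (by norm_num; linarith)]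
    simp only [List.getD_cons_zero, List.getD_cons_succ]
    rw [hseg (x := M) (y := K * (4 * t - 1)) (by ring) (by push_cast; ring), gridMap_column,
      plCurve_const hr]
    simp only [τ, min_eq_right e1, min_eq_right e0, sub_self, add_zero, plCurve_natCast]
  rcases le_total (4 * t) 3 with c3 | c3
  · have e1 : (0 : ℝ) ≤ M * (3 - 4 * t) := mul_nonneg hM'.le (by linarith)
    rw [plCurve_eq_lineMap _ 2 (by simpa using c2) (by norm_num; linarith)]
    simp only [List.getD_cons_zero, List.getD_cons_succ]
    rw [hseg (x := M * (3 - 4 * t)) (y := K) (by push_cast; ring) (by ring), gridMap_row,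
      plCurve_min (w' := fun i => L.getD (k + l - i) 0) h1 e1,
      plCurve_reverse (fun i => L.getD i 0) (le_min e1 hl0)
        ((min_le_right _ _).trans (by push_cast; linarith))]
    simp only [τ, min_eq_right e0, max_eq_left e1]
    congr 1
    push_cast
    ring
  · have e1 : (M : ℝ) * (3 - 4 * t) ≤ 0 := mul_nonpos_of_nonneg_of_nonpos hM'.le (by linarith)
    rw [plCurve_eq_lineMap _ 3 (by simpa using c3) (by norm_num; linarith)]
    simp only [List.getD_cons_zero, List.getD_cons_succ]
    rw [hseg (x := 0) (y := K * (4 - 4 * t)) (by ring) (by push_cast; ring), hcol0,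
      plCurve_const hl]
    simp only [τ, min_eq_right e0, max_eq_right e1, min_eq_left hl0, sub_zero]
    rw [hwL, ← Nat.cast_add, plCurve_natCast]

/-- An elementary homotopy between two paths gives a filling of the same area. -/
theorem ListHtpy.mem_fillingAreas {n : ℕ} {x y : Paths (Coarse (EuclideanSpace ℝ (Fin n)))}
    {f g : x ⟶ y} {c : ℝ} (h : ListHtpy (pathPoints f) (pathPoints g) c) :
    c ∈ fillingAreas (loopPath f g) := by
  obtain ⟨M₀, hM₀⟩ := SeqHtpy.of_listHtpy h
  set p := pathPoints f with hp
  set q := pathPoints g with hq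
  -- The grid must be wide enough for the homotopy and for both paths; the extra one makes the width
  -- visibly positive.
  set M := max M₀ (max (p.length + 1) q.length) with hMdef
  have hMp : p.length + 1 ≤ M := (le_max_left _ _).trans (le_max_right _ _)
  have hMq : q.length ≤ M := (le_max_right _ _).trans (le_max_right _ _)
  obtain ⟨K, w, hK, hw0, hwK, hw, hs⟩ := (hM₀.mono (le_max_left _ _) : SeqHtpy M _ _ _).exists_grid
  have hM : 0 < M := by omega
  refine ⟨gridDisk M K hM hK w, ?_, by rw [area_gridDisk, hs]⟩
  change SamePath _ (polyline (p ++ q.reverse.tail))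
  have hpl : p = p.dropLast ++ [Coarse.pt y] := (dropLast_pathPoints f).symm
  have hpc : p = Coarse.pt x :: p.tail := pathPoints_eq_cons f
  have hql : q = q.dropLast ++ [Coarse.pt y] := (dropLast_pathPoints g).symm
  have hp0 : 0 < p.length := by rw [hpc]; simp
  have hq0 : 0 < q.length := by rw [hql]; simp
  have hrev : q.reverse = Coarse.pt y :: q.reverse.tail := by
    rw [hql]
    simp
  have hL : p ++ q.reverse.tail = p.dropLast ++ q.reverse := by
    conv_lhs => rw [hpl]
    rw [hrev]
    simp
  have hlow : ∀ i ≤ p.length - 1, (p ++ q.reverse.tail).getD i 0 = p.getD i 0 := fun i hi =>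
    List.getD_append _ _ _ _ (by omega)
  have hup : ∀ i ≤ q.length - 1,
      (p ++ q.reverse.tail).getD (p.length - 1 + (q.length - 1) - i) 0 = q.getD i 0 := by
    intro i hi
    rw [hL, List.getD_append_right _ _ _ _ (by rw [List.length_dropLast]; omega),
      List.length_dropLast]
    have h2 : p.length - 1 + (q.length - 1) - i - (p.length - 1) = q.length - 1 - i := by omega
    rw [h2]
    simp only [List.getD]
    rw [List.getElem?_reverse (by omega)]
    congr 2
    omega
  refine samePath_gridDisk hM hK (k := p.length - 1) (l := q.length - 1) ?_ (by omega) (by omega)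
    (fun i => ?_) (fun i => ?_) (fun j => ?_) (fun j => ?_)
  · rw [List.length_append, List.length_tail, List.length_reverse]
    omega
  · rw [hw0, padSeq_eq_getD, hlow _ (min_le_right _ _)]
  · rw [hwK, padSeq_eq_getD, hup _ (min_le_right _ _)]
  · rw [hw j 0 (Or.inl rfl), padSeq_eq_getD, hlow 0 (Nat.zero_le _), Nat.zero_min]
  · rw [hw j M (Or.inr le_rfl), padSeq_eq_getD, hlow _ le_rfl, min_eq_right (by omega)]

/-! ### The equality of the two distances. -/

theorem nonempty_fillingAreas {n : ℕ} {x y : Paths (Coarse (EuclideanSpace ℝ (Fin n)))}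
    (f g : x ⟶ y) : (fillingAreas (loopPath f g)).Nonempty := by
  obtain ⟨c, hc⟩ := ListHtpy.exists_htpy f g
  exact ⟨c, hc.mem_fillingAreas⟩

/-- Every functorial distance lies below every filling area, while every homotopy cost is a filling
area and the infimal cost is a functorial distance. -/
theorem dMax_eq_dArea {n : ℕ} {x y : Paths (Coarse (EuclideanSpace ℝ (Fin n)))}
    (f g : x ⟶ y) : dMax (areaAC n) f g = dArea f g := by
  refine le_antisymm (dMax_le fun φ hφ => le_csInf (nonempty_fillingAreas f g)
    fun r hr => hφ.le_fillingArea f g hr) ?_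
  refine le_trans (le_htpyDist fun c hc => ?_) (le_dMax isFunctorialDistance_htpyDist f g)
  refine csInf_le ⟨0, ?_⟩ hc.mem_fillingAreas
  rintro _ ⟨D, _, rfl⟩
  exact Finset.sum_nonneg fun i _ => triArea_nonneg _ _ _

theorem mainTheorem3 (n : ℕ) :
    (IsFunctorialDistance (areaAC n) (dMax (areaAC n)) ∧
      ∀ φ : ∀ ⦃x y : Paths (Coarse (EuclideanSpace ℝ (Fin n)))⦄, (x ⟶ y) → (x ⟶ y) → ℝ,
        IsFunctorialDistance (areaAC n) φ →
          ∀ (x y : Paths (Coarse (EuclideanSpace ℝ (Fin n)))) (f g : x ⟶ y),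
            φ f g ≤ dMax (areaAC n) f g) ∧
    (∀ (x y : Paths (Coarse (EuclideanSpace ℝ (Fin n)))) (f g : x ⟶ y),
      (fillingAreas (loopPath f g)).Nonempty ∧ dMax (areaAC n) f g = dArea f g) ∧
    (∀ (x y z : EuclideanSpace ℝ (Fin n)) (f : Coarse.mk x ⟶ Coarse.mk y)
        (g : Coarse.mk y ⟶ Coarse.mk z) (h : Coarse.mk x ⟶ Coarse.mk z),
      (areaAC n).d f g h = triArea x y z ∧
      triArea x y z =
        dMax (areaAC n)
          ((Paths.of (Coarse (EuclideanSpace ℝ (Fin n)))).map f ≫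
            (Paths.of (Coarse (EuclideanSpace ℝ (Fin n)))).map g)
          ((Paths.of (Coarse (EuclideanSpace ℝ (Fin n)))).map h)) :=
  ⟨⟨isFunctorialDistance_dMax, fun _ hφ _ _ f g => le_dMax hφ f g⟩,
    fun _ _ f g => ⟨nonempty_fillingAreas f g, dMax_eq_dArea f g⟩,
    fun _ _ _ f g h => ⟨rfl, triArea_eq_dMax f g h⟩⟩
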